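/- All Riesz spaces are real. For a Riesz space $E$ let $E^{\sim}$ be its order dual, i.e. the Riesz space of order bounded linear functionals on $E$, ordered by $f\le g$ iff $f(x)\le g(x)$ for all $x\ge 0$, and let $E^{\sim\sim}=(E^\sim)^\sim$. For Riesz spaces $E_1,\dots,E_m,F$ ($m\in\mathbb N$), let $\mathcal L_r(E_1,\dots,E_m;F)$ be the space of regular $m$-linear operators, i.e. differences of two positive $m$-linear operators (those that are $\ge 0$ on tuples of vectors $\geq 0$). A *Riesz multimorphism* is an operator $A\in\mathcal L_r(E_1,\dots,E_m;F)$ with $|A(x_1,\dots,x_m)|=A(|x_1|,\dots,|x_m|)$ for all $x_i\in E_i$. A map into $F$ has *finite rank* if the sublattice (Riesz subspace) of $F$ generated by its range is finite dimensional. Let $\rho$ be a permutation of $\{1,\dots,m\}$. For $1\le k\le m$ and $x''\in E_{\rho(k)}^{\sim\sim}$, let $\overline{x''}^{\rho}$ be the linear operator from the space of regular multilinear forms in the variables $x_i\in E_i$, $i\notin\{\rho(1),\dots,\rho(k-1)\}$, to the space of regular multilinear forms in the variables $x_i\in E_i$, $i\notin\{\rho(1),\dots,\rho(k)\}$ (which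 is $\mathbb R$ if $k=m$), such that the value of $\overline{x''}^{\rho}(B)$ at $(x_i)_{i\notin\{\rho(1),\dots,\rho(k)\}}$ is $x''$ applied to the functional in $E_{\rho(k)}^\sim$ that sends $t$ to the value of $B$ at $(x_i)_{i\notin\{\rho(1),\dots,\rho(k)\}}$ with $t$ put in the $\rho(k)$-th coordinate. The *Arens extension* $AR_m^\rho(A)\colon E_1^{\sim\sim}\times\cdots\times E_m^{\sim\sim}\to F^{\sim\sim}$ of $A\in\mathcal L_r(E_1,\dots,E_m;F)$ is the $m$-linear operator given by $$AR_m^\rho(A)(x_1'',\dots,x_m'')(y')=\big(\overline{x_{\rho(m)}''}^{\rho}\circ\cdots\circ\overline{x_{\rho(1)}''}^{\rho}\big)(y'\circ A),\qquad y'\in F^\sim .$$ **Theorem.** Let $E_1,\dots,E_m$ be Riesz spaces, let $F$ be an Archimedean Riesz space, and let $A\colon E_1\times\cdots\times E_m\to F$ be a finite rank Riesz multimorphism. Then all the Arens extensions $AR_m^\rho(A)$, where $\rho$ runs over the $m!$ permutations of $\{1,\dots,m\}$, coincide, and they are Riesz multimorphisms on $E_1^{\sim\sim}\times\cdots\times E_m^{\sim\sim}$.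 -/

import Mathlib

/-!  A Riesz space is a real vector space `E` with `[AddCommGroup E] [Lattice E] [IsOrderedAddMonoid E]
[Module ℝ E] [IsOrderedModule ℝ E]`. -/

set_option linter.unusedSectionVars false

noncomputable section

namespace Riesz

/-! ## Linear extension from the positive cone -/

section ConeExtension

variable {E : Type*} [AddCommGroup E] [Lattice E] [IsOrderedAddMonoid E] [Module ℝ E]

theorem cone_sub_eq {p : E → ℝ} (hadd : ∀ x y, 0 ≤ x → 0 ≤ y → p (x + y) = p x + p y)
    {a b c d : E} (ha : 0 ≤ a) (hb : 0 ≤ b) (hc : 0 ≤ c) (hd : 0 ≤ d) (h : a - b = c - d) :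
    p a - p b = p c - p d := by
  have h1 : a + d = c + b := by
    rw [sub_eq_sub_iff_add_eq_add] at h
    exact h
  have h2 := congrArg p h1
  rw [hadd a d ha hd, hadd c b hc hb] at h2
  linarith

variable [IsOrderedModule ℝ E]

/-- The linear functional which agrees on the positive cone with a given additive, positively
homogeneous function. -/
def coneExtension (p : E → ℝ) (hadd : ∀ x y, 0 ≤ x → 0 ≤ y → p (x + y) = p x + p y)
    (hsmul : ∀ (c : ℝ) x, 0 ≤ c → 0 ≤ x → p (c • x) = c * p x) : E →ₗ[ℝ] ℝ where
  toFun x := p x⁺ - p x⁻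
  map_add' x y := by
    have h : p (x + y)⁺ - p (x + y)⁻ = p (x⁺ + y⁺) - p (x⁻ + y⁻) := by
      apply cone_sub_eq hadd (posPart_nonneg _) (negPart_nonneg _)
        (add_nonneg (posPart_nonneg _) (posPart_nonneg _))
        (add_nonneg (negPart_nonneg _) (negPart_nonneg _))
      rw [posPart_sub_negPart, add_sub_add_comm, posPart_sub_negPart, posPart_sub_negPart]
    rw [h, hadd _ _ (posPart_nonneg _) (posPart_nonneg _),
      hadd _ _ (negPart_nonneg _) (negPart_nonneg _)]
    ring
  map_smul' c x := by
    simp only [RingHom.id_apply, smul_eq_mul]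
    rcases le_total 0 c with hc | hc
    · have h : p (c • x)⁺ - p (c • x)⁻ = p (c • x⁺) - p (c • x⁻) := by
        apply cone_sub_eq hadd (posPart_nonneg _) (negPart_nonneg _)
          (smul_nonneg hc (posPart_nonneg _)) (smul_nonneg hc (negPart_nonneg _))
        rw [posPart_sub_negPart, ← smul_sub, posPart_sub_negPart]
      rw [h, hsmul _ _ hc (posPart_nonneg _), hsmul _ _ hc (negPart_nonneg _)]
      ring
    · have hc' : 0 ≤ -c := by linarith
      have h : p (c • x)⁺ - p (c • x)⁻ = p ((-c) • x⁻) - p ((-c) • x⁺) := by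
        apply cone_sub_eq hadd (posPart_nonneg _) (negPart_nonneg _)
          (smul_nonneg hc' (negPart_nonneg _)) (smul_nonneg hc' (posPart_nonneg _))
        rw [posPart_sub_negPart, ← smul_sub, neg_smul, ← smul_neg, neg_sub, posPart_sub_negPart]
      rw [h, hsmul _ _ hc' (posPart_nonneg _), hsmul _ _ hc' (negPart_nonneg _)]
      ring

theorem coneExtension_apply_of_nonneg {p : E → ℝ}
    (hadd : ∀ x y, 0 ≤ x → 0 ≤ y → p (x + y) = p x + p y)
    (hsmul : ∀ (c : ℝ) x, 0 ≤ c → 0 ≤ x → p (c • x) = c * p x) {x : E} (hx : 0 ≤ x) :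
    coneExtension p hadd hsmul x = p x := by
  have h0 : p 0 = 0 := by simpa using hsmul 0 0 le_rfl le_rfl
  change p x⁺ - p x⁻ = p x
  rw [posPart_of_nonneg hx, negPart_of_nonneg hx, h0, sub_zero]

end ConeExtension

/-! ## The order dual -/

section OrderDual

variable (E : Type*) [AddCommGroup E] [Lattice E] [Module ℝ E]

/-- The space of order bounded linear functionals: those which are bounded on every
order interval `{y | |y| ≤ x}`. -/
def orderBoundedFunctionals : Submodule ℝ (E →ₗ[ℝ] ℝ) where
  carrier := {f | ∀ x : E, ∃ M : ℝ, ∀ y : E, |y| ≤ x → |f y| ≤ M}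
  zero_mem' := fun _ => ⟨0, fun y _ => by simp⟩
  add_mem' := by
    intro f g hf hg x
    obtain ⟨M, hM⟩ := hf x
    obtain ⟨N, hN⟩ := hg x
    exact ⟨M + N, fun y hy => (abs_add_le _ _).trans (add_le_add (hM y hy) (hN y hy))⟩
  smul_mem' := by
    intro c f hf x
    obtain ⟨M, hM⟩ := hf x
    refine ⟨|c| * M, fun y hy => ?_⟩
    rw [LinearMap.smul_apply, smul_eq_mul, abs_mul]
    exact mul_le_mul_of_nonneg_left (hM y hy) (abs_nonneg c)

/-- The order dual `E^~` of a Riesz space `E`: the Riesz space of order bounded linear functionals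
on `E`, with `f ≤ g` when `f x ≤ g x` for all `0 ≤ x`. -/
def Dual : Type _ := orderBoundedFunctionals E

namespace Dual

instance : AddCommGroup (Dual E) := inferInstanceAs (AddCommGroup (orderBoundedFunctionals E))
instance : Module ℝ (Dual E) := inferInstanceAs (Module ℝ (orderBoundedFunctionals E))

variable {E}

/-- An order bounded linear functional, as a linear map. -/
def toLinearMap (f : Dual E) : E →ₗ[ℝ] ℝ := f.1

instance : FunLike (Dual E) E ℝ where
  coe f := f.toLinearMap
  coe_injective _ _ h := Subtype.ext (DFunLike.coe_injective h)

instance : LinearMapClass (Dual E) ℝ E ℝ where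
  map_add f := f.toLinearMap.map_add
  map_smulₛₗ f := f.toLinearMap.map_smul

theorem ext {f g : Dual E} (h : ∀ x, f x = g x) : f = g := DFunLike.ext _ _ h

/-- Build an element of the order dual. -/
def mk (f : E →ₗ[ℝ] ℝ) (hf : ∀ x : E, ∃ M : ℝ, ∀ y : E, |y| ≤ x → |f y| ≤ M) : Dual E := ⟨f, hf⟩

@[simp] theorem mk_apply (f : E →ₗ[ℝ] ℝ) (hf) (x : E) : mk f hf x = f x := rfl
@[simp] theorem zero_apply (x : E) : (0 : Dual E) x = 0 := rfl
@[simp] theorem add_apply (f g : Dual E) (x : E) : (f + g) x = f x + g x := rfl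
@[simp] theorem neg_apply (f : Dual E) (x : E) : (-f) x = -f x := rfl
@[simp] theorem sub_apply (f g : Dual E) (x : E) : (f - g) x = f x - g x := rfl
@[simp] theorem smul_apply (c : ℝ) (f : Dual E) (x : E) : (c • f) x = c * f x := rfl

theorem bounded (f : Dual E) (x : E) : ∃ M : ℝ, ∀ y : E, |y| ≤ x → |f y| ≤ M := f.2 x

variable [IsOrderedAddMonoid E]

instance : PartialOrder (Dual E) where
  le f g := ∀ x : E, 0 ≤ x → f x ≤ g x
  le_refl _ _ _ := le_rfl
  le_trans _ _ _ h₁ h₂ x hx := (h₁ x hx).trans (h₂ x hx)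
  le_antisymm f g h₁ h₂ := by
    have h : ∀ x : E, 0 ≤ x → f x = g x := fun x hx => le_antisymm (h₁ x hx) (h₂ x hx)
    refine ext fun x => ?_
    rw [← posPart_sub_negPart x, map_sub, map_sub, h _ (posPart_nonneg x), h _ (negPart_nonneg x)]

theorem le_def {f g : Dual E} : f ≤ g ↔ ∀ x : E, 0 ≤ x → f x ≤ g x := Iff.rfl

instance : IsOrderedAddMonoid (Dual E) where
  add_le_add_left f g h k x hx := by simpa using h x hx

instance : IsOrderedModule ℝ (Dual E) where
  smul_le_smul_of_nonneg_left _ hc _ _ h x hx := mul_le_mul_of_nonneg_left (h x hx) hc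
  smul_le_smul_of_nonneg_right _ hf _ _ h x hx := mul_le_mul_of_nonneg_right h (hf x hx)

/-- A positive functional is monotone. -/
theorem mono {f : Dual E} (hf : 0 ≤ f) {x y : E} (h : x ≤ y) : f x ≤ f y := by
  have := hf (y - x) (sub_nonneg.2 h)
  rw [zero_apply, map_sub] at this
  linarith

theorem abs_le_of_nonneg_of_le {x y : E} (h0 : 0 ≤ y) (h : y ≤ x) : |y| ≤ x := by
  rwa [abs_of_nonneg h0]

/-- On the positive cone, `f⁺ x = sup {f y | 0 ≤ y ≤ x}`. -/
def posFun (f : Dual E) (x : E) : ℝ := sSup (f '' Set.Icc 0 x)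

theorem posFun_bddAbove (f : Dual E) (x : E) : BddAbove (f '' Set.Icc 0 x) := by
  obtain ⟨M, hM⟩ := f.bounded x
  refine ⟨M, ?_⟩
  rintro _ ⟨y, hy, rfl⟩
  exact (le_abs_self _).trans (hM y (abs_le_of_nonneg_of_le hy.1 hy.2))

theorem le_posFun (f : Dual E) {x y : E} (h0 : 0 ≤ y) (h : y ≤ x) : f y ≤ f.posFun x :=
  le_csSup (f.posFun_bddAbove x) ⟨y, ⟨h0, h⟩, rfl⟩

theorem posFun_le (f : Dual E) {x : E} (hx : 0 ≤ x) {M : ℝ}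
    (h : ∀ y, 0 ≤ y → y ≤ x → f y ≤ M) : f.posFun x ≤ M := by
  refine csSup_le ⟨f 0, 0, ⟨le_rfl, hx⟩, rfl⟩ ?_
  rintro _ ⟨y, hy, rfl⟩
  exact h y hy.1 hy.2

theorem posFun_nonneg (f : Dual E) {x : E} (hx : 0 ≤ x) : 0 ≤ f.posFun x := by
  simpa using f.le_posFun le_rfl hx

theorem posFun_add (f : Dual E) (a b : E) (ha : 0 ≤ a) (hb : 0 ≤ b) :
    f.posFun (a + b) = f.posFun a + f.posFun b := by
  apply le_antisymm
  · refine f.posFun_le (add_nonneg ha hb) fun y h0 hy => ?_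
    have h1 : f (y ⊓ a) ≤ f.posFun a := f.le_posFun (le_inf h0 ha) inf_le_right
    have h2 : f (y - y ⊓ a) ≤ f.posFun b := by
      refine f.le_posFun (sub_nonneg.2 inf_le_left) ?_
      rw [sub_le_comm, le_inf_iff]
      exact ⟨sub_le_self _ hb, by rwa [sub_le_iff_le_add]⟩
    rw [map_sub] at h2
    linarith
  · rw [← le_sub_iff_add_le]
    refine f.posFun_le ha fun y h0 hy => ?_
    rw [le_sub_comm]
    refine f.posFun_le hb fun z hz0 hz => ?_
    have := f.le_posFun (add_nonneg h0 hz0) (add_le_add hy hz)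
    rw [map_add] at this
    linarith

variable [IsOrderedModule ℝ E]

theorem posFun_smul_le (f : Dual E) (c : ℝ) (x : E) (hc : 0 < c) (hx : 0 ≤ x) :
    c * f.posFun x ≤ f.posFun (c • x) := by
  rw [← le_div_iff₀' hc]
  refine f.posFun_le hx fun y h0 hy => ?_
  rw [le_div_iff₀' hc]
  have := f.le_posFun (smul_nonneg hc.le h0) (smul_le_smul_of_nonneg_left hy hc.le)
  simpa using this

theorem posFun_smul (f : Dual E) (c : ℝ) (x : E) (hc : 0 ≤ c) (hx : 0 ≤ x) :
    f.posFun (c • x) = c * f.posFun x := by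
  rcases hc.eq_or_lt with rfl | hc
  · have h := f.posFun_add 0 0 le_rfl le_rfl
    rw [add_zero] at h
    rw [zero_smul, zero_mul]
    linarith
  · refine le_antisymm ?_ (f.posFun_smul_le c x hc hx)
    have h := f.posFun_smul_le c⁻¹ (c • x) (inv_pos.2 hc) (smul_nonneg hc.le hx)
    rw [inv_smul_smul₀ hc.ne'] at h
    rwa [inv_mul_le_iff₀ hc] at h

/-- The positive part `f ⊔ 0` of an order bounded functional. -/
def pos (f : Dual E) : Dual E :=
  mk (coneExtension f.posFun f.posFun_add f.posFun_smul) fun x => by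
    refine ⟨f.posFun x, fun y hy => ?_⟩
    have hy' : y⁺ + y⁻ ≤ x := by rwa [posPart_add_negPart]
    have hx : 0 ≤ x := (abs_nonneg y).trans hy
    have key : ∀ z, 0 ≤ z → z ≤ x → f.posFun z ≤ f.posFun x := fun z hz hzx =>
      f.posFun_le hz fun w h0 hw => f.le_posFun h0 (hw.trans hzx)
    have h1 := key _ (posPart_nonneg y)
      ((le_add_of_nonneg_right (negPart_nonneg y)).trans hy')
    have h2 := key _ (negPart_nonneg y)
      ((le_add_of_nonneg_left (posPart_nonneg y)).trans hy')
    have h3 := f.posFun_nonneg (posPart_nonneg y)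
    have h4 := f.posFun_nonneg (negPart_nonneg y)
    change |f.posFun y⁺ - f.posFun y⁻| ≤ _
    rw [abs_le]
    constructor <;> linarith

theorem pos_apply (f : Dual E) {x : E} (hx : 0 ≤ x) : f.pos x = f.posFun x :=
  coneExtension_apply_of_nonneg f.posFun_add f.posFun_smul hx

theorem pos_nonneg (f : Dual E) : 0 ≤ f.pos := fun x hx => by
  rw [pos_apply f hx]
  exact f.posFun_nonneg hx

theorem le_pos (f : Dual E) : f ≤ f.pos := fun x hx => by
  rw [pos_apply f hx]
  exact f.le_posFun hx le_rfl

theorem pos_le {f g : Dual E} (hg : 0 ≤ g) (h : f ≤ g) : f.pos ≤ g := fun x hx => by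
  rw [pos_apply f hx]
  exact f.posFun_le hx fun y h0 hy => (h y h0).trans (mono hg hy)

instance : Lattice (Dual E) where
  sup f g := g + (f - g).pos
  inf f g := f - (f - g).pos
  le_sup_left f g := by
    have := le_pos (f - g)
    rwa [sub_le_iff_le_add'] at this
  le_sup_right f g := le_add_of_nonneg_right (pos_nonneg _)
  sup_le f g h hf hg := by
    rw [← le_sub_iff_add_le']
    exact pos_le (sub_nonneg.2 hg) (sub_le_sub_right hf g)
  inf_le_left f g := sub_le_self _ (pos_nonneg _)
  inf_le_right f g := by
    rw [sub_le_comm]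
    exact le_pos (f - g)
  le_inf f g h hg hh := by
    rw [le_sub_comm]
    exact pos_le (sub_nonneg.2 hg) (sub_le_sub_left hh g)

theorem abs_apply_le {f : Dual E} {x y : E} (h : |x| ≤ y) : |f x| ≤ |f| y := by
  have h1 : f ≤ |f| := le_abs_self f
  have h2 : -f ≤ |f| := neg_le_abs f
  have h3 := h1 _ (posPart_nonneg x)
  have h4 := h1 _ (negPart_nonneg x)
  have h5 := h2 _ (posPart_nonneg x)
  have h6 := h2 _ (negPart_nonneg x)
  rw [neg_apply] at h5 h6
  have h7 : |f| (x⁺ + x⁻) ≤ |f| y := mono (abs_nonneg f) (by rwa [posPart_add_negPart])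
  rw [map_add] at h7
  have h8 : f x = f x⁺ - f x⁻ := by rw [← map_sub, posPart_sub_negPart]
  rw [abs_le, h8]
  constructor <;> linarith

end Dual

end OrderDual

/-! ## Regular multilinear operators and Riesz multimorphisms -/

section Multilinear

variable {ι : Type*} {E : ι → Type*} [∀ i, AddCommGroup (E i)] [∀ i, Lattice (E i)]
  [∀ i, Module ℝ (E i)] {F : Type*} [AddCommGroup F] [Lattice F] [IsOrderedAddMonoid F] [Module ℝ F]

/-- A multilinear operator is positive if it is nonnegative on tuples of nonnegative vectors. -/
def IsPositive (A : MultilinearMap ℝ E F) : Prop :=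
  ∀ x : ∀ i, E i, (∀ i, 0 ≤ x i) → 0 ≤ A x

/-- A multilinear operator is regular if it is a difference of two positive ones. -/
def IsRegular (A : MultilinearMap ℝ E F) : Prop :=
  ∃ A₁ A₂ : MultilinearMap ℝ E F, IsPositive A₁ ∧ IsPositive A₂ ∧ A = A₁ - A₂

/-- A Riesz multimorphism is a regular multilinear operator `A` with
`|A (x₁, …, xₘ)| = A (|x₁|, …, |xₘ|)`. -/
structure IsRieszMultimorphism (A : MultilinearMap ℝ E F) : Prop where
  isRegular : IsRegular A
  abs_apply : ∀ x : ∀ i, E i, |A x| = A fun i => |x i|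

variable (E F) in
/-- The space `L_r(E₁, …, Eₘ; F)` of regular multilinear operators. -/
def regularMultilinear [IsOrderedModule ℝ F] : Submodule ℝ (MultilinearMap ℝ E F) where
  carrier := {A | IsRegular A}
  zero_mem' := ⟨0, 0, fun _ _ => le_rfl, fun _ _ => le_rfl, by simp⟩
  add_mem' := by
    rintro _ _ ⟨A₁, A₂, h₁, h₂, rfl⟩ ⟨B₁, B₂, k₁, k₂, rfl⟩
    exact ⟨A₁ + B₁, A₂ + B₂, fun x hx => add_nonneg (h₁ x hx) (k₁ x hx),
      fun x hx => add_nonneg (h₂ x hx) (k₂ x hx), by abel⟩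
  smul_mem' := by
    rintro c _ ⟨A₁, A₂, h₁, h₂, rfl⟩
    rcases le_total 0 c with hc | hc
    · exact ⟨c • A₁, c • A₂, fun x hx => smul_nonneg hc (h₁ x hx),
        fun x hx => smul_nonneg hc (h₂ x hx), smul_sub c A₁ A₂⟩
    · have hc' : 0 ≤ -c := by linarith
      refine ⟨(-c) • A₂, (-c) • A₁, fun x hx => smul_nonneg hc' (h₂ x hx),
        fun x hx => smul_nonneg hc' (h₁ x hx), ?_⟩
      rw [neg_smul, neg_smul, smul_sub]
      abel

/-- `Dominates C A` means `|A x| ≤ C |x|`. -/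
def Dominates (C A : MultilinearMap ℝ E F) : Prop :=
  ∀ x : ∀ i, E i, |A x| ≤ C fun i => |x i|

variable [∀ i, IsOrderedAddMonoid (E i)] [Finite ι]

theorem IsPositive.dominates {A : MultilinearMap ℝ E F} (hA : IsPositive A) : Dominates A A := by
  classical
  have := Fintype.ofFinite ι
  have key : ∀ (s : Finset ι) (x : ∀ i, E i), (∀ i, i ∉ s → 0 ≤ x i) →
      |A x| ≤ A fun i => |x i| := by
    intro s
    induction s using Finset.induction_on with
    | empty =>
      intro x hx
      have h0 : (fun i => |x i|) = x := funext fun i => abs_of_nonneg (hx i (by simp))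
      rw [h0, abs_of_nonneg (hA x fun i => hx i (by simp))]
    | insert j s _ ih =>
      intro x hx
      have habs : ∀ v : E j, 0 ≤ v →
          (fun i => |Function.update x j v i|) = Function.update (fun i => |x i|) j v := by
        intro v hv
        funext i
        rcases eq_or_ne i j with rfl | hij
        · simp [abs_of_nonneg hv]
        · simp [hij]
      have hcase : ∀ v : E j, 0 ≤ v →
          |A (Function.update x j v)| ≤ A (Function.update (fun i => |x i|) j v) := by
        intro v hv
        rw [← habs v hv]
        refine ih _ fun i hi => ?_
        rcases eq_or_ne i j with rfl | hij
        · simpa using hv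
        · simpa [hij] using hx i (by simp [hij, hi])
      have h1 : A x = A (Function.update x j (x j)⁺) - A (Function.update x j (x j)⁻) := by
        rw [← A.map_update_sub, posPart_sub_negPart, Function.update_eq_self]
      have h2 : (A fun i => |x i|) = A (Function.update (fun i => |x i|) j (x j)⁺)
          + A (Function.update (fun i => |x i|) j (x j)⁻) := by
        rw [← A.map_update_add, posPart_add_negPart, Function.update_eq_self]
      rw [h1, h2, sub_eq_add_neg]
      refine (abs_add_le _ _).trans ?_
      rw [abs_neg]
      exact add_le_add (hcase _ (posPart_nonneg _)) (hcase _ (negPart_nonneg _))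
  exact fun x => key Finset.univ x (by simp)

theorem Dominates.isPositive {C A : MultilinearMap ℝ E F} (h : Dominates C A) : IsPositive C := by
  intro x hx
  have h0 : (fun i => |x i|) = x := funext fun i => abs_of_nonneg (hx i)
  have := (abs_nonneg _).trans (h x)
  rwa [h0] at this

theorem isRegular_iff_exists_dominates {A : MultilinearMap ℝ E F} :
    IsRegular A ↔ ∃ C, Dominates C A := by
  constructor
  · rintro ⟨A₁, A₂, h₁, h₂, rfl⟩
    refine ⟨A₁ + A₂, fun x => ?_⟩
    have : (A₁ - A₂) x = A₁ x + -A₂ x := by simp [sub_eq_add_neg]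
    rw [this]
    refine (abs_add_le _ _).trans ?_
    rw [abs_neg]
    exact add_le_add (h₁.dominates x) (h₂.dominates x)
  · rintro ⟨C, hC⟩
    refine ⟨C, C - A, hC.isPositive, fun x hx => ?_, by abel⟩
    have h0 : (fun i => |x i|) = x := funext fun i => abs_of_nonneg (hx i)
    have := (le_abs_self _).trans (hC x)
    rw [h0] at this
    simpa using this

/-- The functional `t ↦ A (x₁, …, t, …, xₘ)` associated to a regular form, with `t` in the
`i`-th coordinate. -/
def associatedFunctional [DecidableEq ι] (A : regularMultilinear E ℝ) (x : ∀ i, E i) (i : ι) :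
    Dual (E i) :=
  Dual.mk (A.1.toLinearMap x i) fun v => by
    obtain ⟨C, hC⟩ := isRegular_iff_exists_dominates.1 A.2
    refine ⟨C (Function.update (fun j => |x j|) i v), fun t ht => ?_⟩
    have h1 := hC (Function.update x i t)
    have h2 : (fun j => |Function.update x i t j|) = Function.update (fun j => |x j|) i |t| := by
      funext j
      rcases eq_or_ne j i with rfl | hij
      · simp
      · simp [hij]
    rw [h2] at h1
    refine h1.trans ?_
    have h3 : 0 ≤ C (Function.update (fun j => |x j|) i (v - |t|)) := by
      refine hC.isPositive _ fun j => ?_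
      rcases eq_or_ne j i with rfl | hij
      · simpa using ht
      · simp [hij]
    rw [C.map_update_sub] at h3
    linarith

@[simp] theorem associatedFunctional_apply [DecidableEq ι] (A : regularMultilinear E ℝ)
    (x : ∀ i, E i) (i : ι) (t : E i) :
    associatedFunctional A x i t = A.1 (Function.update x i t) := rfl

variable [∀ i, IsOrderedModule ℝ (E i)]

theorem abs_associatedFunctional_le [DecidableEq ι] {A C : regularMultilinear E ℝ}
    (h : Dominates C.1 A.1) (x : ∀ i, E i) (i : ι) :
    |associatedFunctional A x i| ≤ associatedFunctional C (fun j => |x j|) i := by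
  have key : ∀ t : E i, 0 ≤ t → |A.1 (Function.update x i t)| ≤
      C.1 (Function.update (fun j => |x j|) i t) := by
    intro t ht
    have h2 : (fun j => |Function.update x i t j|) = Function.update (fun j => |x j|) i t := by
      funext j
      rcases eq_or_ne j i with rfl | hij
      · simp [abs_of_nonneg ht]
      · simp [hij]
    rw [← h2]
    exact h _
  refine abs_le'.2 ⟨fun t ht => (le_abs_self _).trans (key t ht), fun t ht => ?_⟩
  exact (neg_le_abs _).trans (key t ht)

end Multilinear

/-! ## Arens extensions -/

section Arens

variable {m : ℕ} {E : Fin m → Type*} [∀ i, AddCommGroup (E i)] [∀ i, Lattice (E i)]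
  [∀ i, IsOrderedAddMonoid (E i)] [∀ i, Module ℝ (E i)] [∀ i, IsOrderedModule ℝ (E i)]
  {F : Type*} [AddCommGroup F] [Lattice F] [IsOrderedAddMonoid F] [Module ℝ F]
  [IsOrderedModule ℝ F]

/-- The coordinates that remain when the first `k` coordinates
`ρ 0, …, ρ (k - 1)` in the order given by `ρ` are removed. -/
abbrev Remaining (ρ : Equiv.Perm (Fin m)) (k : ℕ) : Type :=
  {i : Fin m // k ≤ (ρ.symm i : ℕ)}

variable (E) in
/-- The space of regular forms in the coordinates that remain when
`ρ 0, …, ρ (k - 1)` are removed. -/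
abbrev RegularForms (ρ : Equiv.Perm (Fin m)) (k : ℕ) : Type _ :=
  regularMultilinear (fun i : Remaining ρ k => E i) ℝ

/-- The coordinate `ρ k`, as one of those that remain when `ρ 0, …, ρ (k - 1)` are removed. -/
abbrev next (ρ : Equiv.Perm (Fin m)) (k : ℕ) (hk : k < m) : Remaining ρ k :=
  ⟨ρ ⟨k, hk⟩, by simp⟩

/-- Extend a tuple by `0` in the coordinate `ρ k`. -/
def extendByZero (ρ : Equiv.Perm (Fin m)) (k : ℕ) (x : ∀ i : Remaining ρ (k + 1), E i) :
    ∀ i : Remaining ρ k, E i :=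
  fun i => if h : k + 1 ≤ (ρ.symm i : ℕ) then x ⟨i, h⟩ else 0

theorem extendByZero_update (ρ : Equiv.Perm (Fin m)) (k : ℕ)
    (x : ∀ i : Remaining ρ (k + 1), E i) (j : Remaining ρ (k + 1)) (v : E j) :
    extendByZero ρ k (Function.update x j v) = Function.update (extendByZero ρ k x)
      (⟨j, (Nat.le_succ k).trans j.2⟩ : Remaining ρ k) v := by
  funext i
  rcases eq_or_ne i (⟨j, (Nat.le_succ k).trans j.2⟩ : Remaining ρ k) with rfl | hij
  · have h : k + 1 ≤ (ρ.symm j.1 : ℕ) := j.2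
    simp [extendByZero, h]
  · rw [Function.update_of_ne hij]
    unfold extendByZero
    by_cases h : k + 1 ≤ (ρ.symm i.1 : ℕ)
    · have hne : (⟨i.1, h⟩ : Remaining ρ (k + 1)) ≠ j := by
        rintro rfl
        exact hij rfl
      simp [h, Function.update_of_ne hne]
    · simp [h]

theorem abs_extendByZero (ρ : Equiv.Perm (Fin m)) (k : ℕ) (x : ∀ i : Remaining ρ (k + 1), E i) :
    (fun i => |extendByZero ρ k x i|) = extendByZero ρ k fun i => |x i| := by
  funext i
  unfold extendByZero
  split_ifs <;> simp

theorem ne_next (ρ : Equiv.Perm (Fin m)) (k : ℕ) (hk : k < m) (j : Remaining ρ (k + 1)) :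
    (⟨j, (Nat.le_succ k).trans j.2⟩ : Remaining ρ k) ≠ next ρ k hk := by
  intro h
  have h1 : j.1 = ρ ⟨k, hk⟩ := congrArg Subtype.val h
  have h2 := j.2
  rw [h1] at h2
  simp at h2

theorem associatedFunctional_update (ρ : Equiv.Perm (Fin m)) (k : ℕ) (hk : k < m)
    (B : RegularForms E ρ k) (x : ∀ i : Remaining ρ (k + 1), E i) (j : Remaining ρ (k + 1))
    (v : E j) (t : E (next ρ k hk)) :
    associatedFunctional B (extendByZero ρ k (Function.update x j v)) (next ρ k hk) t =
      B.1 (Function.update (Function.update (extendByZero ρ k x) (next ρ k hk) t)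
        (⟨j, (Nat.le_succ k).trans j.2⟩ : Remaining ρ k) v) := by
  have h := ne_next ρ k hk j
  rw [extendByZero_update, associatedFunctional_apply, Function.update_comm h]

/-- The value of `step` as a multilinear form. -/
def stepForm (ρ : Equiv.Perm (Fin m)) (k : ℕ) (hk : k < m) (φ : Dual (Dual (E (next ρ k hk))))
    (B : RegularForms E ρ k) : MultilinearMap ℝ (fun i : Remaining ρ (k + 1) => E i) ℝ :=
  MultilinearMap.mk' (fun x => φ (associatedFunctional B (extendByZero ρ k x) (next ρ k hk)))
    (fun x j v w => by
      rw [← map_add]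
      refine congrArg φ (Dual.ext fun t => ?_)
      rw [Dual.add_apply]
      rw [associatedFunctional_update, associatedFunctional_update, associatedFunctional_update]
      exact B.1.map_update_add _ _ _ _)
    (fun x j c v => by
      rw [← map_smul]
      refine congrArg φ (Dual.ext fun t => ?_)
      rw [Dual.smul_apply]
      rw [associatedFunctional_update, associatedFunctional_update]
      exact B.1.map_update_smul _ _ _ _)

theorem stepForm_dominates (ρ : Equiv.Perm (Fin m)) (k : ℕ) (hk : k < m)
    (φ : Dual (Dual (E (next ρ k hk)))) {B C : RegularForms E ρ k} (h : Dominates C.1 B.1) :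
    Dominates (stepForm ρ k hk |φ| C) (stepForm ρ k hk φ B) := by
  intro x
  have h1 := abs_associatedFunctional_le h (extendByZero ρ k x) (next ρ k hk)
  rw [abs_extendByZero] at h1
  exact Dual.abs_apply_le h1

theorem stepForm_isRegular (ρ : Equiv.Perm (Fin m)) (k : ℕ) (hk : k < m)
    (φ : Dual (Dual (E (next ρ k hk)))) (B : RegularForms E ρ k) :
    IsRegular (stepForm ρ k hk φ B) := by
  obtain ⟨C, hC⟩ := isRegular_iff_exists_dominates.1 B.2
  have hC' : C ∈ regularMultilinear (fun i : Remaining ρ k => E i) ℝ :=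
    isRegular_iff_exists_dominates.2 ⟨C, hC.isPositive.dominates⟩
  exact isRegular_iff_exists_dominates.2
    ⟨_, stepForm_dominates ρ k hk φ (C := ⟨C, hC'⟩) hC⟩

/-- For `φ ∈ (E_{ρ k})^~~`, the operator from the regular forms in the coordinates other than
`ρ 0, …, ρ (k - 1)` to those in the coordinates other than `ρ 0, …, ρ k` which sends `B` to
`x ↦ φ (t ↦ B (x with t in the coordinate ρ k))`. -/
def step (ρ : Equiv.Perm (Fin m)) (k : ℕ) (hk : k < m) (φ : Dual (Dual (E (next ρ k hk)))) :
    RegularForms E ρ k →ₗ[ℝ] RegularForms E ρ (k + 1) where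
  toFun B := ⟨stepForm ρ k hk φ B, stepForm_isRegular ρ k hk φ B⟩
  map_add' B C := by
    refine Subtype.ext (MultilinearMap.ext fun x => ?_)
    exact map_add φ (associatedFunctional B (extendByZero ρ k x) (next ρ k hk))
      (associatedFunctional C (extendByZero ρ k x) (next ρ k hk))
  map_smul' c B := by
    refine Subtype.ext (MultilinearMap.ext fun x => ?_)
    exact map_smul φ c (associatedFunctional B (extendByZero ρ k x) (next ρ k hk))

/-- The composition of the first `k` operators `step`: those for `ρ 0`, …, `ρ (k - 1)`,
the one for `ρ 0` being applied first. -/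
def steps (ρ : Equiv.Perm (Fin m)) (x : ∀ i, Dual (Dual (E i))) :
    (k : ℕ) → k ≤ m → (RegularForms E ρ 0 →ₗ[ℝ] RegularForms E ρ k)
  | 0, _ => LinearMap.id
  | k + 1, hk => (step ρ k hk (x (next ρ k hk))).comp (steps ρ x k (Nat.le_of_succ_le hk))

/-- The form `y' ∘ A`, for `y'` in the order dual of `F` and `A` regular. -/
def compForm (ρ : Equiv.Perm (Fin m)) (A : MultilinearMap ℝ E F) (y : Dual F) :
    MultilinearMap ℝ (fun i : Remaining ρ 0 => E i) ℝ :=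
  MultilinearMap.mk' (fun x => y (A fun i => x ⟨i, Nat.zero_le _⟩))
    (fun x j v w => by
      have h : ∀ u : E j, (fun i => Function.update x j u ⟨i, Nat.zero_le _⟩) =
          Function.update (fun i => x ⟨i, Nat.zero_le _⟩) j.1 u := by
        intro u
        funext i
        rcases eq_or_ne i j.1 with rfl | hij
        · simp
        · have : (⟨i, Nat.zero_le _⟩ : Remaining ρ 0) ≠ j := fun e => hij (congrArg Subtype.val e)
          simp [hij, Function.update_of_ne this]
      simp only [h, A.map_update_add, map_add])
    (fun x j c v => by
      have h : ∀ u : E j, (fun i => Function.update x j u ⟨i, Nat.zero_le _⟩) =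
          Function.update (fun i => x ⟨i, Nat.zero_le _⟩) j.1 u := by
        intro u
        funext i
        rcases eq_or_ne i j.1 with rfl | hij
        · simp
        · have : (⟨i, Nat.zero_le _⟩ : Remaining ρ 0) ≠ j := fun e => hij (congrArg Subtype.val e)
          simp [hij, Function.update_of_ne this]
      simp only [h, A.map_update_smul, map_smul])

theorem compForm_dominates (ρ : Equiv.Perm (Fin m)) {A C : MultilinearMap ℝ E F}
    (h : Dominates C A) {y z : Dual F} (hy : |y| ≤ z) :
    Dominates (compForm ρ C z) (compForm ρ A y) := by
  intro x
  refine (Dual.abs_apply_le (h fun i => x ⟨i, Nat.zero_le _⟩)).trans ?_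
  exact hy _ (h.isPositive _ fun i => abs_nonneg _)

theorem compForm_isRegular (ρ : Equiv.Perm (Fin m)) {A : MultilinearMap ℝ E F}
    (hA : IsRegular A) (y : Dual F) : IsRegular (compForm ρ A y) := by
  obtain ⟨C, hC⟩ := isRegular_iff_exists_dominates.1 hA
  exact isRegular_iff_exists_dominates.2 ⟨_, compForm_dominates ρ hC le_rfl⟩

/-- The operator `y' ↦ y' ∘ A` from the order dual of `F` to the regular forms on
`E₁ × ⋯ × Eₘ`. -/
def comp (ρ : Equiv.Perm (Fin m)) (A : regularMultilinear E F) :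
    Dual F →ₗ[ℝ] RegularForms E ρ 0 where
  toFun y := ⟨compForm ρ A.1 y, compForm_isRegular ρ A.2 y⟩
  map_add' _ _ := Subtype.ext (MultilinearMap.ext fun _ => rfl)
  map_smul' _ _ := Subtype.ext (MultilinearMap.ext fun _ => rfl)

/-- A regular form in no coordinates is a real number. -/
def evalEmpty (ρ : Equiv.Perm (Fin m)) : RegularForms E ρ m →ₗ[ℝ] ℝ where
  toFun B := B.1 fun _ => 0
  map_add' _ _ := rfl
  map_smul' _ _ := rfl

theorem steps_dominates (ρ : Equiv.Perm (Fin m)) (x : ∀ i, Dual (Dual (E i)))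
    {B C : RegularForms E ρ 0} (h : Dominates C.1 B.1) (k : ℕ) (hk : k ≤ m) :
    Dominates (steps ρ (fun i => |x i|) k hk C).1 (steps ρ x k hk B).1 := by
  induction k with
  | zero => exact h
  | succ k ih => exact stepForm_dominates ρ k hk _ (ih (Nat.le_of_succ_le hk))

theorem steps_update_of_le (ρ : Equiv.Perm (Fin m)) (x : ∀ i, Dual (Dual (E i)))
    (j : Fin m) (φ : Dual (Dual (E j))) (k : ℕ) (hk : k ≤ m) (hj : k ≤ (ρ.symm j : ℕ)) :
    steps ρ (Function.update x j φ) k hk = steps ρ x k hk := by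
  induction k with
  | zero => rfl
  | succ k ih =>
    have hne : (next ρ k hk).1 ≠ j := by
      rintro rfl
      simp at hj
    simp only [steps]
    rw [ih _ (Nat.le_of_succ_le hj), Function.update_of_ne hne]

theorem steps_update_add (ρ : Equiv.Perm (Fin m)) (x : ∀ i, Dual (Dual (E i)))
    (j : Fin m) (φ ψ : Dual (Dual (E j))) (k : ℕ) (hk : k ≤ m) (hj : (ρ.symm j : ℕ) < k) :
    steps ρ (Function.update x j (φ + ψ)) k hk =
      steps ρ (Function.update x j φ) k hk + steps ρ (Function.update x j ψ) k hk := by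
  induction k with
  | zero => simp at hj
  | succ k ih =>
    rcases Nat.lt_succ_iff_lt_or_eq.1 hj with h | h
    · have hne : (next ρ k hk).1 ≠ j := by
        rintro rfl
        simp at h
      simp only [steps]
      rw [ih _ h, Function.update_of_ne hne, Function.update_of_ne hne,
        Function.update_of_ne hne, LinearMap.comp_add]
    · obtain rfl : (next ρ k hk).1 = j := by
        change ρ ⟨k, hk⟩ = j
        rw [← Equiv.eq_symm_apply]
        exact Fin.ext h.symm
      simp only [steps]
      rw [steps_update_of_le _ _ _ _ _ _ h.ge, steps_update_of_le _ _ _ _ _ _ h.ge,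
        steps_update_of_le _ _ _ _ _ _ h.ge, Function.update_self, Function.update_self,
        Function.update_self]
      rfl

theorem steps_update_smul (ρ : Equiv.Perm (Fin m)) (x : ∀ i, Dual (Dual (E i)))
    (j : Fin m) (c : ℝ) (φ : Dual (Dual (E j))) (k : ℕ) (hk : k ≤ m) (hj : (ρ.symm j : ℕ) < k) :
    steps ρ (Function.update x j (c • φ)) k hk = c • steps ρ (Function.update x j φ) k hk := by
  induction k with
  | zero => simp at hj
  | succ k ih =>
    rcases Nat.lt_succ_iff_lt_or_eq.1 hj with h | h
    · have hne : (next ρ k hk).1 ≠ j := by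
        rintro rfl
        simp at h
      simp only [steps]
      rw [ih _ h, Function.update_of_ne hne, Function.update_of_ne hne, LinearMap.comp_smul]
    · obtain rfl : (next ρ k hk).1 = j := by
        change ρ ⟨k, hk⟩ = j
        rw [← Equiv.eq_symm_apply]
        exact Fin.ext h.symm
      simp only [steps]
      rw [steps_update_of_le _ _ _ _ _ _ h.ge, steps_update_of_le _ _ _ _ _ _ h.ge,
        Function.update_self, Function.update_self]
      rfl

/-- The value of the Arens extension at `(x₁'', …, xₘ'')`: the functional on `F^~` sending `y'` to
the composition of the operators `step` for `ρ 0`, …, `ρ (m - 1)`, applied to `y' ∘ A`. -/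
def arensValue (ρ : Equiv.Perm (Fin m)) (A : regularMultilinear E F)
    (x : ∀ i, Dual (Dual (E i))) : Dual (Dual F) :=
  Dual.mk ((evalEmpty ρ).comp ((steps ρ x m le_rfl).comp (comp ρ A))) fun z => by
    obtain ⟨C, hC⟩ := isRegular_iff_exists_dominates.1 A.2
    have hC' : C ∈ regularMultilinear E F :=
      isRegular_iff_exists_dominates.2 ⟨C, hC.isPositive.dominates⟩
    refine ⟨evalEmpty ρ (steps ρ (fun i => |x i|) m le_rfl (comp ρ ⟨C, hC'⟩ z)), fun y hy => ?_⟩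
    have h1 : Dominates (comp ρ ⟨C, hC'⟩ z).1 (comp ρ A y).1 := compForm_dominates ρ hC hy
    have h2 := steps_dominates ρ x h1 m le_rfl fun _ => 0
    simp only [abs_zero] at h2
    exact h2

/-- The Arens extension `AR_m^ρ(A) : E₁^~~ × ⋯ × Eₘ^~~ → F^~~` of a regular multilinear operator,
where the coordinates are extended in the order `ρ 0`, `ρ 1`, …, `ρ (m - 1)`. -/
def arensExtension (ρ : Equiv.Perm (Fin m)) (A : regularMultilinear E F) :
    MultilinearMap ℝ (fun i => Dual (Dual (E i))) (Dual (Dual F)) :=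
  MultilinearMap.mk' (arensValue ρ A)
    (fun x j φ ψ => Dual.ext fun y => by
      change evalEmpty ρ (steps ρ _ m le_rfl (comp ρ A y)) = _
      rw [steps_update_add ρ x j φ ψ m le_rfl (ρ.symm j).2]
      rfl)
    (fun x j c φ => Dual.ext fun y => by
      change evalEmpty ρ (steps ρ _ m le_rfl (comp ρ A y)) = _
      rw [steps_update_smul ρ x j c φ m le_rfl (ρ.symm j).2]
      rfl)

end Arens

/-! ## Archimedean Riesz spaces and finite rank -/

section FiniteRank

variable (F : Type*) [AddCommGroup F] [Lattice F]

/-- A Riesz space is Archimedean if `0 ≤ n x ≤ y` for all `n ∈ ℕ` implies `x = 0`. (Mathlib's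
`Archimedean` is a different notion when the order is not total.) -/
def IsArchimedean : Prop :=
  ∀ x y : F, 0 ≤ x → (∀ n : ℕ, n • x ≤ y) → x = 0

variable {F} [Module ℝ F]

/-- A sublattice (Riesz subspace) of a Riesz space: a linear subspace which is closed under the
lattice operations. -/
structure IsRieszSubspace (G : Submodule ℝ F) : Prop where
  sup_mem : ∀ x ∈ G, ∀ y ∈ G, x ⊔ y ∈ G
  inf_mem : ∀ x ∈ G, ∀ y ∈ G, x ⊓ y ∈ G

/-- The sublattice (Riesz subspace) generated by a set. -/
def generated (s : Set F) : Submodule ℝ F :=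
  sInf {G | IsRieszSubspace G ∧ s ⊆ G}

theorem subset_generated (s : Set F) : s ⊆ generated s := fun x hx => by
  simp only [generated, SetLike.mem_coe, Submodule.mem_sInf]
  exact fun G hG => hG.2 hx

theorem generated_isRieszSubspace (s : Set F) : IsRieszSubspace (generated s) where
  sup_mem x hx y hy := by
    simp only [generated, Submodule.mem_sInf] at *
    exact fun G hG => hG.1.sup_mem x (hx G hG) y (hy G hG)
  inf_mem x hx y hy := by
    simp only [generated, Submodule.mem_sInf] at *
    exact fun G hG => hG.1.inf_mem x (hx G hG) y (hy G hG)

/-- A map into a Riesz space has finite rank if the sublattice generated by its range is finite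
dimensional. -/
def HasFiniteRank {X : Type*} (A : X → F) : Prop :=
  FiniteDimensional ℝ (generated (Set.range A))

end FiniteRank

end Riesz

end

noncomputable section

namespace Riesz

/-! ## Disjoint elements -/

section Disjoint

variable {F : Type*} [AddCommGroup F] [Lattice F] [IsOrderedAddMonoid F]

/-! The range of `A` lies in a finite dimensional Riesz subspace of the Archimedean space `F`. Such
a subspace is spanned by pairwise disjoint positive vectors `e j`, namely by any disjoint system of
maximal cardinality (`exists_isDisjointSystem_forall_eq_sum`). Since `|∑ t j • e j| = ∑ |t j| • e j`
for disjoint vectors, each coordinate of `A` is again a Riesz multimorphism, now with real values. A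
real Riesz multimorphism is a nonnegative multiple of a product of real Riesz homomorphisms, one in
each variable (`exists_eq_mul_prod`). Hence `A x = ∑ j, (c j * ∏ i, φ j i (x i)) • e j`.

On such a sum each step of the Arens extension replaces one factor `φ j i (x i)` by `f i (φ j i)`,
where `f i` is the given element of the bidual. The order of these replacements does not affect the
product, so every extension sends `f` to the canonical image of `∑ j, (c j * ∏ i, f i (φ j i)) • e
j` (`arensExtension_apply`).

This formula commutes with absolute values for three reasons: the canonical map into the bidual is a
Riesz homomorphism (`Dual.abs_eval`), the `e j` are disjoint, and `|f| φ = |f φ|` when `φ` is a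
Riesz homomorphism, because `φ` is then an atom of the dual (`Dual.abs_apply_of_isRieszHom`). -/

theorem inf_eq_zero_of_le {a b c : F} (hc : 0 ≤ c) (ha : 0 ≤ a) (hcb : c ≤ b) (h : a ⊓ b = 0) :
    a ⊓ c = 0 :=
  le_antisymm (h ▸ inf_le_inf_left a hcb) (le_inf ha hc)

/-- Subtracting `b` from `a ⊓ (b + c)` leaves something below `a ⊓ c = 0`; thus `a ⊓ (b + c)` is
already below `a ⊓ b`. -/
theorem inf_add_eq_zero {a b c : F} (ha : 0 ≤ a) (hb : 0 ≤ b) (hc : 0 ≤ c)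
    (h₁ : a ⊓ b = 0) (h₂ : a ⊓ c = 0) : a ⊓ (b + c) = 0 := by
  apply le_antisymm _ (le_inf ha (add_nonneg hb hc))
  have h : a ⊓ (b + c) - b ≤ 0 := by
    rw [← h₂, le_inf_iff]
    refine ⟨(sub_le_self _ hb).trans inf_le_left, ?_⟩
    rw [sub_le_iff_le_add']
    exact inf_le_right
  rw [← h₁]
  exact le_inf inf_le_left (sub_nonpos.1 h)

theorem inf_sum_eq_zero {ι : Type*} (s : Finset ι) {a : F} {b : ι → F} (ha : 0 ≤ a)
    (hb : ∀ i ∈ s, 0 ≤ b i) (h : ∀ i ∈ s, a ⊓ b i = 0) : a ⊓ ∑ i ∈ s, b i = 0 := by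
  classical
  induction s using Finset.induction_on with
  | empty => simpa using ha
  | insert j s hj ih =>
    rw [Finset.sum_insert hj]
    simp only [Finset.mem_insert, forall_eq_or_imp] at hb h
    exact inf_add_eq_zero ha hb.1 (Finset.sum_nonneg hb.2) h.1 (ih hb.2 h.2)

theorem inf_nsmul_eq_zero {a b : F} (ha : 0 ≤ a) (hb : 0 ≤ b) (h : a ⊓ b = 0) (n : ℕ) :
    a ⊓ n • b = 0 := by
  simpa using inf_sum_eq_zero (Finset.range n) (b := fun _ => b) ha (fun _ _ => hb) fun _ _ => h

/-- Disjointness gives `a ⊔ b = a + b`, which forces `a` and `b` to be the positive and negative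
parts of `a - b`. -/
theorem abs_sub_eq_add_of_inf_eq_zero {a b : F} (h : a ⊓ b = 0) : |a - b| = a + b := by
  have h1 : (a - b)⁺ = a := by
    rw [posPart_def, ← sub_self b, ← sup_sub]
    have := inf_add_sup a b
    rw [h, zero_add] at this
    rw [this, add_sub_cancel_right]
  have h2 : (a - b)⁻ = b := by
    have := posPart_sub_negPart (a - b)
    rw [h1] at this
    exact sub_right_injective this
  rw [← posPart_add_negPart, h1, h2]

variable [Module ℝ F] [IsOrderedModule ℝ F]

theorem inf_smul_eq_zero {a b : F} (ha : 0 ≤ a) (hb : 0 ≤ b) (h : a ⊓ b = 0) {c : ℝ}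
    (hc : 0 ≤ c) : a ⊓ c • b = 0 := by
  obtain ⟨n, hn⟩ := exists_nat_ge c
  refine inf_eq_zero_of_le (smul_nonneg hc hb) ha ?_ (inf_nsmul_eq_zero ha hb h n)
  rw [← Nat.cast_smul_eq_nsmul ℝ]
  exact smul_le_smul_of_nonneg_right hn hb

theorem smul_inf_smul_eq_zero {a b : F} (ha : 0 ≤ a) (hb : 0 ≤ b) (h : a ⊓ b = 0) {c d : ℝ}
    (hc : 0 ≤ c) (hd : 0 ≤ d) : c • a ⊓ d • b = 0 := by
  refine inf_smul_eq_zero (smul_nonneg hc ha) hb ?_ hd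
  rw [inf_comm]
  exact inf_smul_eq_zero hb ha (by rwa [inf_comm]) hc

/-- Splitting the coefficients by sign writes the sum as a difference of two positive sums. These
are disjoint: distinct indices by hypothesis, equal indices because `(c i)⁺` or `(c i)⁻` is zero. -/
theorem abs_sum_smul_of_disjoint {ι : Type*} [Fintype ι] {e : ι → F} (he : ∀ i, 0 ≤ e i)
    (hd : ∀ i j, i ≠ j → e i ⊓ e j = 0) (c : ι → ℝ) :
    |∑ i, c i • e i| = ∑ i, |c i| • e i := by
  have h1 : ∑ i, c i • e i = ∑ i, (c i)⁺ • e i - ∑ i, (c i)⁻ • e i := by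
    rw [← Finset.sum_sub_distrib]
    refine Finset.sum_congr rfl fun i _ => ?_
    rw [← sub_smul, posPart_sub_negPart]
  have h2 : ∑ i, |c i| • e i = ∑ i, (c i)⁺ • e i + ∑ i, (c i)⁻ • e i := by
    rw [← Finset.sum_add_distrib]
    refine Finset.sum_congr rfl fun i _ => ?_
    rw [← add_smul, posPart_add_negPart]
  rw [h1, h2]
  apply abs_sub_eq_add_of_inf_eq_zero
  refine inf_sum_eq_zero _ (Finset.sum_nonneg fun i _ => smul_nonneg (posPart_nonneg _) (he i))
    (fun i _ => smul_nonneg (negPart_nonneg _) (he i)) fun i _ => ?_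
  rw [inf_comm]
  refine inf_sum_eq_zero _ (smul_nonneg (negPart_nonneg _) (he i))
    (fun j _ => smul_nonneg (posPart_nonneg _) (he j)) fun j _ => ?_
  rcases eq_or_ne i j with rfl | hij
  · rcases le_total 0 (c i) with h | h
    · rw [negPart_of_nonneg h, zero_smul]
      exact inf_eq_left.2 (smul_nonneg (posPart_nonneg _) (he i))
    · rw [posPart_of_nonpos h, zero_smul]
      exact inf_eq_right.2 (smul_nonneg (negPart_nonneg _) (he i))
  · exact smul_inf_smul_eq_zero (he i) (he j) (hd i j hij) (negPart_nonneg _) (posPart_nonneg _)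

theorem linearIndependent_of_disjoint {ι : Type*} [Fintype ι] {e : ι → F} (he : ∀ i, 0 < e i)
    (hd : ∀ i j, i ≠ j → e i ⊓ e j = 0) : LinearIndependent ℝ e := by
  rw [Fintype.linearIndependent_iff]
  intro c hc i
  have h := abs_sum_smul_of_disjoint (fun i => (he i).le) hd c
  rw [hc, abs_zero, eq_comm, Finset.sum_eq_zero_iff_of_nonneg
    fun i _ => smul_nonneg (abs_nonneg _) (he i).le] at h
  simpa [(he i).ne'] using h i (Finset.mem_univ i)

end Disjoint

/-! ## Finite dimensional Archimedean Riesz spaces -/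

section FiniteDimensional

variable {F : Type*} [AddCommGroup F] [Lattice F] [IsOrderedAddMonoid F] [Module ℝ F]
  [IsOrderedModule ℝ F]

/-- A finite set of strictly positive, pairwise disjoint elements of `G`. -/
structure IsDisjointSystem (G : Submodule ℝ F) (s : Finset F) : Prop where
  mem : ∀ a ∈ s, a ∈ G
  pos : ∀ a ∈ s, 0 < a
  disjoint : ∀ a ∈ s, ∀ b ∈ s, a ≠ b → a ⊓ b = 0

/-- The dimension bounds the size of disjoint systems, so one of maximal cardinality exists. -/
theorem IsDisjointSystem.card_le {G : Submodule ℝ F} [FiniteDimensional ℝ G] {s : Finset F}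
    (hs : IsDisjointSystem G s) : s.card ≤ Module.finrank ℝ G := by
  have h : LinearIndependent ℝ fun a : s => (a : F) :=
    linearIndependent_of_disjoint (fun a => hs.pos a a.2) fun a b hab =>
      hs.disjoint a a.2 b b.2 fun h => hab (Subtype.ext h)
  have h' : LinearIndependent ℝ fun a : s => (⟨a, hs.mem a a.2⟩ : G) :=
    LinearIndependent.of_comp G.subtype h
  simpa using h'.fintype_card_le_finrank

theorem IsDisjointSystem.cons {G : Submodule ℝ F} {s : Finset F} [DecidableEq F]
    (hs : IsDisjointSystem G s) {a : F} (haG : a ∈ G) (ha : 0 < a) (h : ∀ b ∈ s, a ⊓ b = 0) :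
    IsDisjointSystem G (insert a s) where
  mem := by
    simp only [Finset.mem_insert, forall_eq_or_imp]
    exact ⟨haG, hs.mem⟩
  pos := by
    simp only [Finset.mem_insert, forall_eq_or_imp]
    exact ⟨ha, hs.pos⟩
  disjoint := by
    simp only [Finset.mem_insert, forall_eq_or_imp]
    exact ⟨⟨fun h => (h rfl).elim, fun b hb _ => h b hb⟩, fun b hb =>
      ⟨fun _ => by rw [inf_comm]; exact h b hb, hs.disjoint b hb⟩⟩

theorem notMem_of_inf_eq_zero {s : Finset F} {a : F} (ha : 0 < a) (h : ∀ b ∈ s, a ⊓ b = 0) :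
    a ∉ s := fun hs => ha.ne' (by simpa using h a hs)

theorem IsDisjointSystem.mono {G : Submodule ℝ F} {s t : Finset F} (hs : IsDisjointSystem G s)
    (h : t ⊆ s) : IsDisjointSystem G t :=
  ⟨fun a ha => hs.mem a (h ha), fun a ha => hs.pos a (h ha),
    fun a ha b hb => hs.disjoint a (h ha) b (h hb)⟩

/-- A member of a disjoint system of maximal cardinality does not dominate two nonzero disjoint
elements. -/
theorem IsDisjointSystem.eq_zero_or_eq_zero {G : Submodule ℝ F} {s : Finset F}
    (hs : IsDisjointSystem G s) (hmax : ∀ t, IsDisjointSystem G t → t.card ≤ s.card)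
    {e u v : F} (he : e ∈ s) (huG : u ∈ G) (hvG : v ∈ G) (hu : 0 ≤ u) (hv : 0 ≤ v)
    {c : ℝ} (hc : 0 ≤ c) (hue : u ≤ c • e) (hve : v ≤ c • e) (huv : u ⊓ v = 0) :
    u = 0 ∨ v = 0 := by
  classical
  by_contra! h
  have hu' := hu.lt_of_ne' h.1
  have hv' := hv.lt_of_ne' h.2
  -- Whatever lies under a multiple of `e` is disjoint from the rest of `s`. If `u` and `v` were
  -- both nonzero, exchanging `e` for the pair would enlarge the system.
  have key : ∀ w, 0 ≤ w → w ≤ c • e → ∀ b ∈ s.erase e, w ⊓ b = 0 := by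
    intro w hw hwe b hb
    have hb' := Finset.mem_erase.1 hb
    rw [inf_comm]
    refine inf_eq_zero_of_le hw (hs.pos b hb'.2).le hwe ?_
    exact inf_smul_eq_zero (hs.pos b hb'.2).le (hs.pos e he).le
      (hs.disjoint b hb'.2 e he hb'.1) hc
  have h1 := (hs.mono (s.erase_subset e)).cons hvG hv' (key v hv hve)
  have hu1 : ∀ b ∈ insert v (s.erase e), u ⊓ b = 0 := by
    simp only [Finset.mem_insert, forall_eq_or_imp]
    exact ⟨huv, key u hu hue⟩
  have h2 := hmax _ (h1.cons huG hu' hu1)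
  rw [Finset.card_insert_of_notMem (notMem_of_inf_eq_zero hu' hu1),
    Finset.card_insert_of_notMem (notMem_of_inf_eq_zero hv' (key v hv hve)),
    Finset.card_erase_of_mem he] at h2
  have := Finset.card_pos.2 ⟨e, he⟩
  omega

/-- `IsArchimedean` speaks of positive elements only; it is applied to `x⁺`, using `n • x⁺ = (n •
x)⁺`. -/
theorem IsArchimedean.nonpos (hF : IsArchimedean F) {x y : F} (hy : 0 ≤ y)
    (h : ∀ n : ℕ, (n : ℝ) • x ≤ y) : x ≤ 0 := by
  rw [← posPart_eq_zero]
  refine hF _ y (posPart_nonneg x) fun n => ?_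
  have h1 : n • x⁺ = (n : ℝ) • x ⊔ 0 := by
    rcases Nat.eq_zero_or_pos n with rfl | hn
    · simp
    · have hn' : (0 : ℝ) < n := Nat.cast_pos.2 hn
      rw [← Nat.cast_smul_eq_nsmul ℝ]
      apply le_antisymm
      · rw [← le_inv_smul_iff_of_pos hn', posPart_def]
        refine sup_le ?_ ?_
        · rw [le_inv_smul_iff_of_pos hn']
          exact le_sup_left
        · exact smul_nonneg (inv_nonneg.2 hn'.le) le_sup_right
      · exact sup_le (smul_le_smul_of_nonneg_left (le_posPart x) hn'.le)
          (smul_nonneg hn'.le (posPart_nonneg x))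
  rw [h1]
  exact sup_le (h n) hy

theorem IsArchimedean.nonpos_of_forall_pos_le (hF : IsArchimedean F) {x y : F} (hy : 0 ≤ y)
    (h : ∀ ε : ℝ, 0 < ε → x ≤ ε • y) : x ≤ 0 := by
  refine hF.nonpos hy fun n => ?_
  rcases Nat.eq_zero_or_pos n with rfl | hn
  · simpa using hy
  · have hn' : (0 : ℝ) < n := Nat.cast_pos.2 hn
    rw [← le_inv_smul_iff_of_pos hn']
    exact h _ (inv_pos.2 hn')

theorem IsRieszSubspace.posPart_mem {G : Submodule ℝ F} (hG : IsRieszSubspace G) {x : F}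
    (hx : x ∈ G) : x⁺ ∈ G := hG.sup_mem x hx 0 G.zero_mem

theorem IsRieszSubspace.negPart_mem {G : Submodule ℝ F} (hG : IsRieszSubspace G) {x : F}
    (hx : x ∈ G) : x⁻ ∈ G := hG.sup_mem (-x) (G.neg_mem hx) 0 G.zero_mem

/-- Since `x⁺ = x + x⁻`, translation by `x⁻` turns the infimum into `x ⊓ 0 + x⁻`, and `x ⊓ 0 = -x⁻`.
-/
theorem posPart_inf_negPart (x : F) : x⁺ ⊓ x⁻ = 0 := by
  have h := inf_add_sup x 0
  have h1 : x⁺ ⊓ x⁻ = (x ⊓ 0) + x⁻ := by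
    rw [inf_add, zero_add]
    congr 1
    rw [← sub_eq_iff_eq_add, posPart_sub_negPart]
  rw [h1, ← neg_inj, neg_add, neg_inf, neg_zero, ← negPart_def, add_neg_cancel]

/-- The number `c` is the largest one with `c • e ≤ x`. Let `w` be the infimum of the remainder and
`e`. By maximality of `s`, for each `ε > 0` one of the two parts of `w - ε • e` vanishes. If it is
the negative part, `ε • e` fits under the remainder and `c` was not largest; so `w ≤ ε • e` for all
`ε > 0`, and `w = 0`. -/
theorem IsDisjointSystem.exists_sub_smul_disjoint (hF : IsArchimedean F) {G : Submodule ℝ F}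
    (hG : IsRieszSubspace G) {s : Finset F}
    (hs : IsDisjointSystem G s) (hmax : ∀ t, IsDisjointSystem G t → t.card ≤ s.card)
    {e x : F} (he : e ∈ s) (hxG : x ∈ G) (hx : 0 ≤ x) :
    ∃ c : ℝ, 0 ≤ c ∧ 0 ≤ x - c • e ∧ (x - c • e) ⊓ e = 0 := by
  have he0 := hs.pos e he
  have heG := hs.mem e he
  set S : Set ℝ := {c | c • e ≤ x} with hS
  have h0 : (0 : ℝ) ∈ S := by simpa [hS] using hx
  have hdown : ∀ c ∈ S, ∀ d ≤ c, d ∈ S := fun c hc d hd =>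
    (smul_le_smul_of_nonneg_right hd he0.le).trans hc
  have hbdd : BddAbove S := by
    by_contra hb
    refine he0.not_ge (hF.nonpos hx fun n => ?_)
    obtain ⟨c, hc, hn⟩ := not_bddAbove_iff.1 hb n
    exact hdown c hc n hn.le
  have hc0 : 0 ≤ sSup S := le_csSup hbdd h0
  -- The supremum is attained: `(sSup S - ε) • e ≤ x` for every `ε > 0`, and `F` is Archimedean.
  have hcS : sSup S ∈ S := by
    have : sSup S • e - x ≤ 0 := by
      refine hF.nonpos_of_forall_pos_le he0.le fun ε hε => ?_
      obtain ⟨d, hd, hlt⟩ := exists_lt_of_lt_csSup ⟨0, h0⟩ (sub_lt_self (sSup S) hε)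
      have h1 : (sSup S - ε) • e ≤ x := hdown d hd _ hlt.le
      rw [sub_smul, sub_le_iff_le_add] at h1
      rwa [sub_le_iff_le_add']
    exact sub_nonpos.1 this
  have hr : 0 ≤ x - sSup S • e := sub_nonneg.2 hcS
  refine ⟨sSup S, hc0, hr, ?_⟩
  set w := (x - sSup S • e) ⊓ e with hw
  have hw0 : 0 ≤ w := le_inf hr he0.le
  have hwG : w ∈ G := hG.inf_mem _ (G.sub_mem hxG (G.smul_mem _ heG)) _ heG
  refine le_antisymm (hF.nonpos_of_forall_pos_le he0.le fun ε hε => ?_) hw0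
  have hzG : w - ε • e ∈ G := G.sub_mem hwG (G.smul_mem _ heG)
  have hεe : 0 ≤ ε • e := smul_nonneg hε.le he0.le
  -- A crude bound that serves for both parts; any common multiple of `e` would do.
  have h1 : (w - ε • e)⁺ ≤ (1 + ε) • e := by
    rw [add_smul, one_smul]
    refine sup_le ?_ (add_nonneg he0.le hεe)
    exact (sub_le_self _ hεe).trans (inf_le_right.trans (le_add_of_nonneg_right hεe))
  have h2 : (w - ε • e)⁻ ≤ (1 + ε) • e := by
    rw [add_smul, one_smul, negPart_def, neg_sub]
    refine sup_le ?_ (add_nonneg he0.le hεe)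
    exact (sub_le_self _ hw0).trans (le_add_of_nonneg_left he0.le)
  rcases hs.eq_zero_or_eq_zero hmax he (hG.posPart_mem hzG) (hG.negPart_mem hzG)
    (posPart_nonneg _) (negPart_nonneg _) (by positivity) h1 h2 (posPart_inf_negPart _) with h | h
  · exact sub_nonpos.1 (posPart_eq_zero.1 h)
  · have h3 : ε • e ≤ w := sub_nonneg.1 (negPart_eq_zero.1 h)
    have h4 : sSup S + ε ∈ S := by
      have := h3.trans inf_le_left
      rw [le_sub_iff_add_le'] at this
      rwa [hS, Set.mem_ofPred_eq, add_smul]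
    have := le_csSup hbdd h4
    linarith

/-- A finite dimensional Riesz subspace of an Archimedean Riesz space is spanned by finitely many
pairwise disjoint positive elements. -/
theorem exists_isDisjointSystem_forall_eq_sum (hF : IsArchimedean F) {G : Submodule ℝ F}
    (hG : IsRieszSubspace G) [FiniteDimensional ℝ G] :
    ∃ s : Finset F, IsDisjointSystem G s ∧ ∀ x ∈ G, ∃ c : F → ℝ, x = ∑ a ∈ s, c a • a := by
  classical
  obtain ⟨s, hs, hmax⟩ : ∃ s, IsDisjointSystem G s ∧
      ∀ t, IsDisjointSystem G t → t.card ≤ s.card := by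
    have hb : BddAbove (Finset.card '' {s | IsDisjointSystem G s}) := by
      refine ⟨Module.finrank ℝ G, ?_⟩
      rintro _ ⟨s, hs, rfl⟩
      exact hs.card_le
    have hne : (Finset.card '' {s | IsDisjointSystem G s}).Nonempty :=
      ⟨_, ∅, ⟨by simp, by simp, by simp⟩, rfl⟩
    obtain ⟨s, hs, h⟩ := Nat.sSup_mem hne hb
    exact ⟨s, hs, fun t ht => h ▸ le_csSup hb ⟨t, ht, rfl⟩⟩
  refine ⟨s, hs, ?_⟩
  have hpos : ∀ x ∈ G, 0 ≤ x → ∃ c : F → ℝ, x = ∑ a ∈ s, c a • a := by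
    intro x hxG hx
    -- The elements of `s` are split off from `x` one at a time.
    have key : ∀ t ⊆ s, ∃ c : F → ℝ, 0 ≤ x - ∑ a ∈ t, c a • a ∧
        ∀ b ∈ t, (x - ∑ a ∈ t, c a • a) ⊓ b = 0 := by
      intro t
      induction t using Finset.induction_on with
      | empty => exact fun _ => ⟨0, by simpa using hx, by simp⟩
      | insert e t het ih =>
        intro hts
        obtain ⟨c, hc, hd⟩ := ih ((Finset.subset_insert e t).trans hts)
        have hes : e ∈ s := hts (Finset.mem_insert_self e t)
        have hts' : t ⊆ s := (Finset.subset_insert e t).trans hts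
        obtain ⟨d, hd0, hdn, hde⟩ := hs.exists_sub_smul_disjoint hF hG hmax hes
          (G.sub_mem hxG (G.sum_mem fun a ha => G.smul_mem (c a) (hs.mem a (hts' ha)))) hc
        have hsum : x - ∑ a ∈ insert e t, Function.update c e d a • a =
            x - ∑ a ∈ t, c a • a - d • e := by
          rw [Finset.sum_insert het, Function.update_self, sub_sub, add_comm (d • e)]
          congr 2
          refine Finset.sum_congr rfl fun a ha => ?_
          rw [Function.update_of_ne]
          rintro rfl
          exact het ha
        refine ⟨Function.update c e d, ?_, ?_⟩
        · rwa [hsum]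
        · rw [hsum]
          simp only [Finset.mem_insert, forall_eq_or_imp]
          refine ⟨hde, fun b hb => ?_⟩
          rw [inf_comm]
          -- The remainder only decreases, so it stays disjoint from the elements already treated.
          refine inf_eq_zero_of_le hdn (hs.pos b (hts' hb)).le
            (sub_le_self _ (smul_nonneg hd0 (hs.pos e hes).le)) ?_
          rw [inf_comm]
          exact hd b hb
    obtain ⟨c, hc, hd⟩ := key s subset_rfl
    -- A nonzero remainder, being disjoint from all of `s`, could be added to `s`.
    refine ⟨c, sub_eq_zero.1 (by_contra fun hne => ?_)⟩
    have hlt := hc.lt_of_ne' hne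
    have h1 := hmax _ (hs.cons
      (G.sub_mem hxG (G.sum_mem fun a ha => G.smul_mem (c a) (hs.mem a ha))) hlt hd)
    rw [Finset.card_insert_of_notMem (notMem_of_inf_eq_zero hlt hd)] at h1
    omega
  intro x hx
  obtain ⟨c, hc⟩ := hpos _ (hG.posPart_mem hx) (posPart_nonneg x)
  obtain ⟨d, hd⟩ := hpos _ (hG.negPart_mem hx) (negPart_nonneg x)
  refine ⟨c - d, ?_⟩
  rw [← posPart_sub_negPart x, hc, hd, ← Finset.sum_sub_distrib]
  simp only [Pi.sub_apply, sub_smul]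

end FiniteDimensional

/-! ## Riesz homomorphisms into the reals and the bidual -/

section Functionals

variable {V : Type*} [AddCommGroup V] [Module ℝ V]

theorem exists_eq_mul_of_ker_le (f g : V → ℝ) (hf : IsLinearMap ℝ f) (hg : IsLinearMap ℝ g)
    (h : ∀ x, g x = 0 → f x = 0) : ∃ c : ℝ, ∀ x, f x = c * g x := by
  by_cases hg0 : ∀ x, g x = 0
  · exact ⟨0, fun x => by rw [zero_mul, h x (hg0 x)]⟩
  · push Not at hg0
    obtain ⟨s, hs⟩ := hg0
    refine ⟨f s / g s, fun x => ?_⟩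
    have h1 := h (g s • x - g x • s) (by
      rw [hg.map_sub, hg.map_smul, hg.map_smul, smul_eq_mul, smul_eq_mul]; ring)
    rw [hf.map_sub, hf.map_smul, hf.map_smul, smul_eq_mul, smul_eq_mul, sub_eq_zero] at h1
    field_simp
    linarith

end Functionals

namespace Dual

variable {E : Type*} [AddCommGroup E] [Lattice E] [IsOrderedAddMonoid E] [Module ℝ E]
  [IsOrderedModule ℝ E]

theorem isLinearMap (f : Dual E) : IsLinearMap ℝ f :=
  ⟨fun x y => map_add f x y, fun c x => map_smul f c x⟩

theorem posPart_apply (f : Dual E) {x : E} (hx : 0 ≤ x) : f⁺ x = f.posFun x := by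
  have h : f⁺ = f.pos := by
    change 0 + (f - 0).pos = f.pos
    rw [zero_add, sub_zero]
  rw [h, pos_apply f hx]

theorem abs_apply (f : Dual E) {x : E} (hx : 0 ≤ x) : |f| x = 2 * f.posFun x - f x := by
  have h : |f| = f⁺ + f⁺ - f := by
    rw [← posPart_add_negPart f]
    nth_rewrite 5 [← posPart_sub_negPart f]
    abel
  rw [h, sub_apply, add_apply, posPart_apply f hx]
  ring

/-- A Riesz homomorphism into the reals, as an element of the order dual. -/
def IsRieszHom (φ : Dual E) : Prop := ∀ x, |φ x| = φ |x|

theorem IsRieszHom.nonneg {φ : Dual E} (hφ : IsRieszHom φ) : 0 ≤ φ := fun x hx => by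
  rw [zero_apply, ← abs_of_nonneg hx, ← hφ x]
  exact abs_nonneg _

/-- A Riesz homomorphism into the reals is an atom of the order dual. -/
theorem IsRieszHom.exists_eq_smul {φ ψ : Dual E} (hφ : IsRieszHom φ) (h0 : 0 ≤ ψ) (h : ψ ≤ φ) :
    ∃ c : ℝ, ψ = c • φ := by
  -- From `|ψ x| ≤ φ |x| = |φ x|`, the kernel of `φ` is contained in that of `ψ`.
  obtain ⟨c, hc⟩ := exists_eq_mul_of_ker_le ψ φ ψ.isLinearMap φ.isLinearMap fun x hx => by
    have h1 : |ψ x| ≤ φ |x| := by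
      have := abs_apply_le (f := ψ) (le_refl |x|)
      rw [abs_of_nonneg h0] at this
      exact this.trans (h _ (abs_nonneg x))
    rw [← hφ x, hx, abs_zero] at h1
    exact abs_nonpos_iff.1 h1
  exact ⟨c, ext hc⟩

/-- The order interval from `0` to `φ` consists of multiples `t • φ` with `0 ≤ t ≤ 1`. Hence `f⁺ φ =
max (f φ) 0`, and `|f| = 2 f⁺ - f` gives the value. -/
theorem abs_apply_of_isRieszHom (f : Dual (Dual E)) {φ : Dual E} (hφ : IsRieszHom φ) :
    |f| φ = |f φ| := by
  apply le_antisymm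
  · rw [abs_apply f hφ.nonneg]
    have h : f.posFun φ ≤ max (f φ) 0 := by
      refine f.posFun_le hφ.nonneg fun ψ h0 h => ?_
      by_cases hφ0 : φ = 0
      · rw [le_antisymm (h.trans hφ0.le) h0, map_zero]
        exact le_max_right _ _
      · obtain ⟨c, rfl⟩ := hφ.exists_eq_smul h0 h
        obtain ⟨x, hx, hlt⟩ : ∃ x, 0 ≤ x ∧ 0 < φ x := by
          by_contra! hno
          exact hφ0 (le_antisymm (fun x hx => hno x hx) hφ.nonneg)
        have h1 := h0 x hx
        have h2 := h x hx
        rw [zero_apply, smul_apply] at h1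
        rw [smul_apply] at h2
        have hc0 : 0 ≤ c := nonneg_of_mul_nonneg_left h1 hlt
        have hc1 : c ≤ 1 := by
          by_contra! hc
          nlinarith
        rw [map_smul, smul_eq_mul]
        rcases le_total 0 (f φ) with hp | hp
        · exact (mul_le_of_le_one_left hp hc1).trans (le_max_left _ _)
        · exact (mul_nonpos_of_nonneg_of_nonpos hc0 hp).trans (le_max_right _ _)
    rcases le_total 0 (f φ) with hp | hp
    · rw [max_eq_left hp] at h
      rw [abs_of_nonneg hp]
      linarith
    · rw [max_eq_right hp] at h
      rw [abs_of_nonpos hp]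
      linarith
  · exact abs_apply_le (abs_of_nonneg hφ.nonneg).le

/-- The canonical image of `x` in the bidual. -/
def eval (x : E) : Dual (Dual E) :=
  mk { toFun := fun f => f x, map_add' := fun _ _ => rfl, map_smul' := fun _ _ => rfl }
    fun g => ⟨g |x|, fun _ hf => (abs_apply_le le_rfl).trans (hf _ (abs_nonneg x))⟩

@[simp] theorem eval_apply (x : E) (f : Dual E) : eval x f = f x := rfl

theorem inf_nsmul_bddAbove {f : Dual E} (hf : 0 ≤ f) (u y : E) :
    BddAbove (Set.range fun n : ℕ => f (y ⊓ n • u)) := by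
  refine ⟨f y, ?_⟩
  rintro _ ⟨n, rfl⟩
  exact mono hf inf_le_left

theorem inf_add_le {a b c : E} (ha : 0 ≤ a) (hb : 0 ≤ b) (hc : 0 ≤ c) :
    (a + b) ⊓ c ≤ a ⊓ c + b ⊓ c := by
  rw [add_inf, inf_add, inf_add]
  refine le_inf (le_inf inf_le_left ?_) (le_inf ?_ ?_)
  · exact inf_le_right.trans (le_add_of_nonneg_right hb)
  · exact inf_le_right.trans (le_add_of_nonneg_left ha)
  · exact inf_le_right.trans (le_add_of_nonneg_right hc)

/-- For `0 ≤ f` and disjoint `0 ≤ u, v` there is `0 ≤ g ≤ f` which agrees with `f` at `u` and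
vanishes at `v`. -/
theorem exists_le_apply_eq {f : Dual E} (hf : 0 ≤ f) {u v : E} (hu : 0 ≤ u) (hv : 0 ≤ v)
    (huv : u ⊓ v = 0) : ∃ g : Dual E, 0 ≤ g ∧ g ≤ f ∧ g u = f u ∧ g v = 0 := by
  -- On the positive cone this is the part of `f` carried by the ideal generated by `u`. The term `n
  -- = 1` gives the value at `u`, and `v ⊓ n • u = 0` gives the value at `v`.
  set p : E → ℝ := fun y => ⨆ n : ℕ, f (y ⊓ n • u) with hp
  have hnu : ∀ n : ℕ, 0 ≤ n • u := fun n => nsmul_nonneg hu n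
  have hle : ∀ y (n : ℕ), f (y ⊓ n • u) ≤ p y := fun y n => le_ciSup (inf_nsmul_bddAbove hf u y) n
  have hpf : ∀ y, p y ≤ f y := fun y => ciSup_le fun n => mono hf inf_le_left
  have hp0 : ∀ y, 0 ≤ y → 0 ≤ p y := fun y hy => by
    have h := hle y 0
    rwa [zero_smul, inf_eq_right.2 hy, map_zero] at h
  have hadd : ∀ x y, 0 ≤ x → 0 ≤ y → p (x + y) = p x + p y := by
    intro x y hx hy
    apply le_antisymm
    · refine ciSup_le fun n => ?_
      refine (mono hf (inf_add_le hx hy (hnu n))).trans ?_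
      rw [map_add]
      exact add_le_add (hle x n) (hle y n)
    · refine ciSup_add_ciSup_le fun n k => ?_
      rw [← map_add]
      refine (mono hf ?_).trans (hle (x + y) (n + k))
      rw [add_smul]
      exact le_inf (add_le_add inf_le_left inf_le_left) (add_le_add inf_le_right inf_le_right)
  have hmono : ∀ x y, 0 ≤ x → x ≤ y → p x ≤ p y := by
    intro x y hx hxy
    have h := hadd x (y - x) hx (sub_nonneg.2 hxy)
    rw [add_sub_cancel] at h
    rw [h]
    exact le_add_of_nonneg_right (hp0 _ (sub_nonneg.2 hxy))
  have hsmul_le : ∀ (c : ℝ) y, 0 < c → 0 ≤ y → c * p y ≤ p (c • y) := by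
    intro c y hc hy
    rw [← le_div_iff₀' hc]
    refine ciSup_le fun n => ?_
    rw [le_div_iff₀' hc]
    obtain ⟨k, hk⟩ := exists_nat_ge (c * n)
    rw [← smul_eq_mul, ← map_smul]
    refine (mono hf (le_inf (smul_le_smul_of_nonneg_left inf_le_left hc.le) ?_)).trans (hle _ k)
    refine (smul_le_smul_of_nonneg_left inf_le_right hc.le).trans ?_
    rw [← Nat.cast_smul_eq_nsmul ℝ, ← Nat.cast_smul_eq_nsmul ℝ, smul_smul]
    exact smul_le_smul_of_nonneg_right hk hu
  have hsmul : ∀ (c : ℝ) y, 0 ≤ c → 0 ≤ y → p (c • y) = c * p y := by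
    intro c y hc hy
    rcases hc.eq_or_lt with rfl | hc
    · have h := hadd 0 0 le_rfl le_rfl
      rw [add_zero] at h
      rw [zero_smul, zero_mul]
      linarith
    · refine le_antisymm ?_ (hsmul_le c y hc hy)
      have h := hsmul_le c⁻¹ (c • y) (inv_pos.2 hc) (smul_nonneg hc.le hy)
      rw [inv_smul_smul₀ hc.ne'] at h
      rwa [inv_mul_le_iff₀ hc] at h
  have happly : ∀ y, 0 ≤ y → coneExtension p hadd hsmul y = p y := fun y hy =>
    coneExtension_apply_of_nonneg hadd hsmul hy
  refine ⟨mk (coneExtension p hadd hsmul) fun x => ⟨p x, fun y hy => ?_⟩, ?_, ?_, ?_, ?_⟩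
  · have h1 := hp0 _ (posPart_nonneg y)
    have h2 := hp0 _ (negPart_nonneg y)
    have h3 := hadd _ _ (posPart_nonneg y) (negPart_nonneg y)
    rw [posPart_add_negPart] at h3
    have h4 := hmono _ _ (abs_nonneg y) hy
    change |p y⁺ - p y⁻| ≤ _
    rw [abs_le]
    constructor <;> linarith
  · intro y hy
    rw [mk_apply, happly y hy]
    exact hp0 y hy
  · intro y hy
    rw [mk_apply, happly y hy]
    exact hpf y
  · rw [mk_apply, happly u hu]
    refine le_antisymm (hpf u) ?_
    have h := hle u 1
    rwa [one_smul, inf_idem] at h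
  · rw [mk_apply, happly v hv]
    refine le_antisymm (ciSup_le fun n => ?_) (hp0 v hv)
    rw [inf_nsmul_eq_zero hv hu (by rwa [inf_comm]), map_zero]

/-- The canonical map into the bidual is a Riesz homomorphism. -/
theorem abs_eval (x : E) : |eval x| = eval |x| := by
  apply le_antisymm
  · exact abs_le'.2 ⟨fun f hf => mono hf (le_abs_self x), fun f hf => by
      rw [neg_apply, eval_apply, ← map_neg]
      exact mono hf (neg_le_abs x)⟩
  · intro f hf
    -- Here `g x = f x⁺`, so the positive part of `eval x` is at least `f x⁺` at `f`; then `|eval x|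
    -- f ≥ 2 * f x⁺ - f x = f |x|`.
    obtain ⟨g, hg0, hgf, hgu, hgv⟩ := exists_le_apply_eq hf (posPart_nonneg x) (negPart_nonneg x)
      (posPart_inf_negPart x)
    have h := (eval x).le_posFun hg0 hgf
    have h1 : g x = g x⁺ - g x⁻ := by rw [← map_sub, posPart_sub_negPart]
    have h2 : f x = f x⁺ - f x⁻ := by rw [← map_sub, posPart_sub_negPart]
    have h3 : f |x| = f x⁺ + f x⁻ := by rw [← map_add, posPart_add_negPart]
    rw [abs_apply _ hf, eval_apply, eval_apply]
    rw [eval_apply] at h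
    linarith

end Dual

/-! ## Multimorphisms into the reals -/

section Multimorphism

variable {ι : Type*} [Fintype ι] {E : ι → Type*} [∀ i, AddCommGroup (E i)] [∀ i, Lattice (E i)]
  [∀ i, IsOrderedAddMonoid (E i)] [∀ i, Module ℝ (E i)] [∀ i, IsOrderedModule ℝ (E i)]

theorem abs_update [DecidableEq ι] (x : ∀ i, E i) (i : ι) (t : E i) :
    (fun j => |Function.update x i t j|) = Function.update (fun j => |x j|) i |t| := by
  funext j
  rcases eq_or_ne j i with rfl | hij
  · simp
  · simp [hij]

/-- Up to scalars, `B` gives only one functional of the `i`-th variable when the others are fixed at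
`x` or at `y`: both functionals are multiples of the one obtained at `|x| + |y|`, whose kernel is
contained in theirs by monotonicity of `B`. -/
theorem update_mul_update_comm [DecidableEq ι] {B : MultilinearMap ℝ E ℝ}
    (hB : ∀ x, |B x| = B fun i => |x i|) (x y : ∀ i, E i) (i : ι) (s t : E i) :
    B (Function.update x i t) * B (Function.update y i s) =
      B (Function.update x i s) * B (Function.update y i t) := by
  have hpos : IsPositive B := fun x hx => by
    have h := hB x
    rw [funext fun i => abs_of_nonneg (hx i)] at h
    rw [← h]
    exact abs_nonneg _
  have hlin : ∀ z : ∀ i, E i, IsLinearMap ℝ fun t => B (Function.update z i t) := fun z =>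
    ⟨fun t s => B.map_update_add z i t s, fun c t => B.map_update_smul z i c t⟩
  have hmono : ∀ (x y : ∀ i, E i), (∀ i, 0 ≤ x i) → (∀ i, x i ≤ y i) → B x ≤ B y := by
    intro x y hx hxy
    -- The coordinates of `x` are raised to those of `y` one at a time.
    have key : ∀ s : Finset ι, B x ≤ B (s.piecewise y x) := by
      intro s
      induction s using Finset.induction_on with
      | empty => simp
      | insert j s hj ih =>
        refine ih.trans ?_
        rw [Finset.piecewise_insert]
        have h1 : s.piecewise y x = Function.update (s.piecewise y x) j (x j) := by
          rw [eq_comm, Function.update_eq_self_iff]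
          simp [hj]
        rw [h1, Function.update_idem, ← sub_nonneg, ← B.map_update_sub]
        refine hpos _ fun l => ?_
        rcases eq_or_ne l j with rfl | hl
        · simpa using hxy l
        · rw [Function.update_of_ne hl]
          by_cases hls : l ∈ s
          · simpa [hls] using (hx l).trans (hxy l)
          · simpa [hls] using hx l
    simpa using key Finset.univ
  set z : ∀ i, E i := fun i => |x i| + |y i| with hz
  have hker : ∀ w : ∀ i, E i, (∀ j, |w j| ≤ z j) → ∀ t, B (Function.update z i t) = 0 →
      B (Function.update w i t) = 0 := by
    intro w hw t ht
    rw [← abs_eq_zero, hB, abs_update] at ht ⊢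
    have hnonneg : ∀ j, 0 ≤ Function.update (fun j => |w j|) i |t| j := fun j => by
      rw [← abs_update]
      exact abs_nonneg _
    refine le_antisymm ?_ (hpos _ hnonneg)
    rw [← ht]
    refine hmono _ _ hnonneg fun j => ?_
    rcases eq_or_ne j i with rfl | hj
    · simp
    · rw [Function.update_of_ne hj, Function.update_of_ne hj]
      exact (hw j).trans (le_abs_self (z j))
  obtain ⟨a, ha⟩ := exists_eq_mul_of_ker_le _ _ (hlin x) (hlin z)
    (hker x fun j => le_add_of_nonneg_right (abs_nonneg _))
  obtain ⟨b, hb⟩ := exists_eq_mul_of_ker_le _ _ (hlin y) (hlin z)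
    (hker y fun j => le_add_of_nonneg_left (abs_nonneg _))
  rw [ha, ha, hb, hb]
  ring

/-- A real Riesz multimorphism is a multiple of a product of Riesz homomorphisms. -/
theorem exists_eq_mul_prod {B : MultilinearMap ℝ E ℝ} (hB : ∀ x, |B x| = B fun i => |x i|) :
    ∃ (c : ℝ) (φ : ∀ i, Dual (E i)), (∀ i, (φ i).IsRieszHom) ∧ 0 ≤ c ∧
      ∀ x, B x = c * ∏ i, φ i (x i) := by
  classical
  by_cases h0 : ∀ x, B x = 0
  · exact ⟨0, 0, fun i x => by simp, le_rfl, fun x => by rw [h0 x, zero_mul]⟩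
  push Not at h0
  obtain ⟨w, hw⟩ := h0
  set u : ∀ i, E i := fun i => |w i| with hu
  have hc : 0 < B u := by
    rw [hu, ← hB]
    exact abs_pos.2 hw
  have huabs : (fun i => |u i|) = u := funext fun i => abs_of_nonneg (abs_nonneg _)
  have habs : ∀ i t, |B (Function.update u i t)| = B (Function.update u i |t|) := fun i t => by
    rw [hB, abs_update, huabs]
  -- The `i`-th factor is `B` with the other variables frozen at `u`, normalised to be `1` at `u i`.
  set φ : ∀ i, Dual (E i) := fun i => Dual.mk ((B u)⁻¹ • B.toLinearMap u i) fun v => by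
    refine ⟨(B u)⁻¹ * B (Function.update u i v), fun t ht => ?_⟩
    change |(B u)⁻¹ * B (Function.update u i t)| ≤ _
    rw [abs_mul, abs_of_pos (inv_pos.2 hc), habs]
    refine mul_le_mul_of_nonneg_left ?_ (inv_pos.2 hc).le
    rw [← sub_nonneg, ← B.map_update_sub, ← abs_of_nonneg (sub_nonneg.2 ht), ← habs]
    exact abs_nonneg _ with hφ
  have hφ_apply : ∀ i t, φ i t = (B u)⁻¹ * B (Function.update u i t) := fun i t => rfl
  refine ⟨B u, φ, fun i t => ?_, hc.le, fun x => ?_⟩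
  · rw [hφ_apply, hφ_apply, abs_mul, abs_of_pos (inv_pos.2 hc), habs]
  · have key : ∀ s : Finset ι, B x = B (s.piecewise u x) * ∏ i ∈ s, φ i (x i) := by
      intro s
      induction s using Finset.induction_on with
      | empty => simp
      | insert j s hj ih =>
        rw [ih, Finset.prod_insert hj, Finset.piecewise_insert, hφ_apply]
        have h1 : Function.update (s.piecewise u x) j (x j) = s.piecewise u x := by
          rw [Function.update_eq_self_iff]
          simp [hj]
        -- Exchanging `x j` for `u j` in the `j`-th coordinate costs exactly the factor `φ j (x j)`.
        have h2 := update_mul_update_comm hB (s.piecewise u x) u j (u j) (x j)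
        rw [h1, Function.update_eq_self] at h2
        rw [← mul_assoc]
        congr 1
        field_simp
        linarith
    simpa using key Finset.univ

end Multimorphism

/-! ## Arens extensions of finite sums of elementary multimorphisms -/

section Arens

variable {m : ℕ} {E : Fin m → Type*} [∀ i, AddCommGroup (E i)] [∀ i, Lattice (E i)]
  [∀ i, IsOrderedAddMonoid (E i)] [∀ i, Module ℝ (E i)] [∀ i, IsOrderedModule ℝ (E i)]
  {F : Type*} [AddCommGroup F] [Lattice F] [IsOrderedAddMonoid F] [Module ℝ F]
  [IsOrderedModule ℝ F]

/-- The value of `steps` on `y' ∘ A`, where `A = ∑ j, c j • (∏ i, φ j i) ⊗ e j`. -/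
theorem steps_comp_apply {J : Type*} [Fintype J] (A : regularMultilinear E F) (e : J → F)
    (c : J → ℝ) (φ : J → ∀ i, Dual (E i))
    (hA : ∀ x, A.1 x = ∑ j, (c j * ∏ i, φ j i (x i)) • e j) (ρ : Equiv.Perm (Fin m))
    (f : ∀ i, Dual (Dual (E i))) (y : Dual F) (k : ℕ) (hk : k ≤ m)
    (x : ∀ i : Remaining ρ k, E i) :
    (steps ρ f k hk (comp ρ A y)).1 x = ∑ j, y (e j) * c j *
      ∏ i, if h : k ≤ (ρ.symm i : ℕ) then φ j i (x ⟨i, h⟩) else f i (φ j i) := by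
  induction k with
  | zero =>
    change y (A.1 fun i => x ⟨i, Nat.zero_le _⟩) = _
    rw [hA, map_sum]
    refine Finset.sum_congr rfl fun j _ => ?_
    rw [map_smul, smul_eq_mul]
    simp only [Nat.zero_le, dif_pos]
    ring
  | succ k ih =>
    set n := next ρ k hk with hn
    -- All factors except the one for coordinate `ρ k`; they do not involve the variable `t` put
    -- there. The functional of `t` is therefore a combination of the `φ j (ρ k)`, to which `f (ρ
    -- k)` applies linearly.
    set d : J → ℝ := fun j => y (e j) * c j * ∏ i ∈ Finset.univ.erase n.1,
      if h : k + 1 ≤ (ρ.symm i : ℕ) then φ j i (x ⟨i, h⟩) else f i (φ j i) with hd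
    have hnk : (ρ.symm n.1 : ℕ) = k := by simp [hn]
    have hfun : associatedFunctional (steps ρ f k (Nat.le_of_succ_le hk) (comp ρ A y))
        (extendByZero ρ k x) n = ∑ j, d j • φ j n.1 := by
      refine Dual.ext fun t => ?_
      have hsum : (∑ j, d j • φ j n.1) t = ∑ j, d j * φ j n.1 t :=
        map_sum (Dual.eval t) _ _
      rw [hsum, associatedFunctional_apply, ih]
      refine Finset.sum_congr rfl fun j _ => ?_
      rw [← Finset.mul_prod_erase _ _ (Finset.mem_univ n.1), dif_pos n.2, Function.update_self, hd]
      have hprod : ∀ i ∈ Finset.univ.erase n.1,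
          (if h : k ≤ (ρ.symm i : ℕ) then
            φ j i (Function.update (extendByZero ρ k x) n t ⟨i, h⟩) else f i (φ j i)) =
          if h : k + 1 ≤ (ρ.symm i : ℕ) then φ j i (x ⟨i, h⟩) else f i (φ j i) := by
        intro i hi
        have hin := (Finset.mem_erase.1 hi).1
        have hne : (ρ.symm i : ℕ) ≠ k := fun h => hin (by
          apply ρ.symm.injective
          exact Fin.ext (h.trans hnk.symm))
        by_cases h : k + 1 ≤ (ρ.symm i : ℕ)
        · have h' : k ≤ (ρ.symm i : ℕ) := (Nat.le_succ k).trans h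
          have hin' : (⟨i, h'⟩ : Remaining ρ k) ≠ n := fun e => hin (congrArg Subtype.val e)
          rw [dif_pos h, dif_pos h', Function.update_of_ne hin']
          simp [extendByZero, h]
        · have h' : ¬ k ≤ (ρ.symm i : ℕ) := by omega
          rw [dif_neg h, dif_neg h']
      rw [Finset.prod_congr rfl hprod]
      ring
    change f n.1 (associatedFunctional _ (extendByZero ρ k x) n) = _
    rw [hfun, map_sum]
    refine Finset.sum_congr rfl fun j _ => ?_
    have h' : ¬ k + 1 ≤ (ρ.symm n.1 : ℕ) := by omega
    rw [map_smul, smul_eq_mul, ← Finset.mul_prod_erase _ _ (Finset.mem_univ n.1), dif_neg h', hd]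
    ring

/-- The right-hand side does not involve `ρ`, which is the coincidence of all the extensions. -/
theorem arensExtension_apply {J : Type*} [Fintype J] (A : regularMultilinear E F) (e : J → F)
    (c : J → ℝ) (φ : J → ∀ i, Dual (E i))
    (hA : ∀ x, A.1 x = ∑ j, (c j * ∏ i, φ j i (x i)) • e j) (ρ : Equiv.Perm (Fin m))
    (f : ∀ i, Dual (Dual (E i))) :
    arensExtension ρ A f = Dual.eval (∑ j, (c j * ∏ i, f i (φ j i)) • e j) := by
  refine Dual.ext fun y => ?_
  change (steps ρ f m le_rfl (comp ρ A y)).1 (fun _ => 0) = y _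
  rw [steps_comp_apply A e c φ hA, map_sum]
  refine Finset.sum_congr rfl fun j _ => ?_
  have h : ∀ i, ¬ m ≤ (ρ.symm i : ℕ) := fun i => by omega
  simp only [h, dif_neg, not_false_eq_true]
  rw [map_smul, smul_eq_mul]
  ring

/-- A finite rank Riesz multimorphism is a finite sum of products of Riesz homomorphisms into the
reals, with values on pairwise disjoint positive vectors. -/
theorem exists_eq_sum_prod_smul (hF : IsArchimedean F) {A : MultilinearMap ℝ E F}
    (hA : ∀ x, |A x| = A fun i => |x i|) (hfin : HasFiniteRank A) :
    ∃ (s : Finset F) (c : s → ℝ) (φ : s → ∀ i, Dual (E i)),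
      (∀ a : s, 0 ≤ (a : F)) ∧ (∀ a b : s, a ≠ b → (a : F) ⊓ b = 0) ∧ (∀ a, 0 ≤ c a) ∧
      (∀ a i, (φ a i).IsRieszHom) ∧ ∀ x, A x = ∑ a, (c a * ∏ i, φ a i (x i)) • (a : F) := by
  have : FiniteDimensional ℝ (generated (Set.range A)) := hfin
  obtain ⟨s, hs, hspan⟩ :=
    exists_isDisjointSystem_forall_eq_sum hF (generated_isRieszSubspace (Set.range A))
  have hpos : ∀ a : s, 0 ≤ (a : F) := fun a => (hs.pos a a.2).le
  have hdisj : ∀ a b : s, a ≠ b → (a : F) ⊓ b = 0 := fun a b hab =>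
    hs.disjoint a a.2 b b.2 fun h => hab (Subtype.ext h)
  have hli : LinearIndependent ℝ fun a : s => (a : F) :=
    linearIndependent_of_disjoint (fun a => hs.pos a a.2) hdisj
  -- A linear choice of coordinates with respect to `s`, defined on all of `F`, so that its
  -- composition with `A` is multilinear.
  obtain ⟨π, hπ⟩ :=
    (Fintype.linearCombination ℝ fun a : s => (a : F)).exists_leftInverse_of_injective
    (LinearMap.ker_eq_bot.2 (linearIndependent_iff_injective_fintypeLinearCombination.1 hli))
  have hπ_sum : ∀ d : s → ℝ, π (∑ a, d a • (a : F)) = d := fun d => LinearMap.congr_fun hπ d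
  have hrep : ∀ x, A x = ∑ a : s, π (A x) a • (a : F) := by
    intro x
    obtain ⟨d, hd⟩ := hspan (A x) (subset_generated _ ⟨x, rfl⟩)
    rw [← Finset.sum_coe_sort] at hd
    rw [hd, hπ_sum fun a => d a]
  set B : s → MultilinearMap ℝ E ℝ := fun a => ((LinearMap.proj a).comp π).compMultilinearMap A
  have hB : ∀ a x, |B a x| = B a fun i => |x i| := by
    intro a x
    change |π (A x) a| = π (A fun i => |x i|) a
    -- On the span of the disjoint vectors, taking coordinates commutes with absolute values.
    rw [← hA, hrep x, abs_sum_smul_of_disjoint hpos hdisj, hπ_sum, hπ_sum]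
  choose c φ hφ hc h using fun a => exists_eq_mul_prod (hB a)
  refine ⟨s, c, φ, hpos, hdisj, hc, hφ, fun x => ?_⟩
  rw [hrep x]
  exact Finset.sum_congr rfl fun a _ => congrArg (· • (a : F)) (h a x)

end Arens

end Riesz

end

/-! ### Coincidence of the Arens extensions and the multimorphism property -/

theorem theorem3p2 {m : ℕ} {E : Fin m → Type*}
    [∀ i, AddCommGroup (E i)] [∀ i, Lattice (E i)] [∀ i, IsOrderedAddMonoid (E i)]
    [∀ i, Module ℝ (E i)] [∀ i, IsOrderedModule ℝ (E i)]
    {F : Type*} [AddCommGroup F] [Lattice F] [IsOrderedAddMonoid F] [Module ℝ F]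
    [IsOrderedModule ℝ F] (hF : Riesz.IsArchimedean F)
    (A : MultilinearMap ℝ E F) (hA : Riesz.IsRieszMultimorphism A) (hfin : Riesz.HasFiniteRank A) :
    (∀ ρ σ : Equiv.Perm (Fin m),
      Riesz.arensExtension ρ ⟨A, hA.isRegular⟩ = Riesz.arensExtension σ ⟨A, hA.isRegular⟩) ∧
    ∀ ρ : Equiv.Perm (Fin m),
      Riesz.IsRieszMultimorphism (Riesz.arensExtension ρ ⟨A, hA.isRegular⟩) := by
  obtain ⟨s, c, φ, hpos, hdisj, hc, hφ, hsum⟩ :=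
    Riesz.exists_eq_sum_prod_smul hF hA.abs_apply hfin
  have h := Riesz.arensExtension_apply ⟨A, hA.isRegular⟩ _ c φ hsum
  refine ⟨fun ρ σ => MultilinearMap.ext fun f => (h ρ f).trans (h σ f).symm, fun ρ => ?_⟩
  have habs : ∀ f, |Riesz.arensExtension ρ ⟨A, hA.isRegular⟩ f| =
      Riesz.arensExtension ρ ⟨A, hA.isRegular⟩ fun i => |f i| := by
    intro f
    rw [h, h, Riesz.Dual.abs_eval, Riesz.abs_sum_smul_of_disjoint hpos hdisj]
    congr 1
    refine Finset.sum_congr rfl fun a _ => ?_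
    rw [abs_mul, abs_of_nonneg (hc a), Finset.abs_prod]
    simp only [Riesz.Dual.abs_apply_of_isRieszHom _ (hφ a _)]
  -- Regularity comes for free: by `habs` the extension dominates itself.
  exact ⟨Riesz.isRegular_iff_exists_dominates.2 ⟨_, fun f => (habs f).le⟩, habs⟩
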